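/- **Lemma.** Let $(S,g)$ be a compact smooth two-dimensional Riemannian manifold without boundary, with Levi-Civita connection $\nabla$, Gauss curvature $\hat k$, and Riemannian area measure $\varepsilon$ (if $S$ is oriented, integration against $\varepsilon$ is integration against the volume form). Indices are raised and lowered with $g$ and repeated indices are summed. (a) For every $C^\infty$ one-form $\beta$ on $S$, both integrands below are integrable and $$\int_S \left[(\nabla^A\beta^B)(\nabla_A\beta_B)+\hat k\,\beta^A\beta_A\right]\varepsilon=\int_S\left[\tfrac12(\nabla^A\beta^B-\nabla^B\beta^A)(\nabla_A\beta_B-\nabla_B\beta_A)+(\nabla^A\beta_A)^2\right]\varepsilon .$$ (b) For every $C^\infty$ symmetric, trace-free tensor field $Z_{AB}$ on $S$, both integrands below are integrable and $$\int_S\left[(\nabla^A Z^{BC})(\nabla_A Z_{BC})+2\hat k\,Z^{AB}Z_{AB}\right]\varepsilon=2\int_S g^{AB}(\nabla^C Z_{CA})(\nabla^D Z_{DB})\,\varepsilon .$$ (c) If $\hat k>0$ everywhere on $S$, then every $C^\infty$ one-form $\beta$ with $\nabla^A\beta_A=0$ and $\nabla_A\beta_B-\nabla_B\beta_A=0$ vanishes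 identically, and every $C^\infty$ symmetric tensor field $Z_{AB}$ with $g^{AB}Z_{AB}=0$ and $\nabla^C Z_{CA}=0$ vanishes identically. -/

import Mathlib

open scoped Manifold ContDiff Bundle
open MeasureTheory

noncomputable section

namespace Surface

/-- The model space `ℝ²` of a surface. -/
abbrev Plane : Type := EuclideanSpace ℝ (Fin 2)

/-- A smooth Riemannian metric on a smooth surface `S` (without boundary, as the model is `ℝ²`). -/
abbrev Metric (S : Type*) [TopologicalSpace S] [ChartedSpace Plane S] [IsManifold (𝓡 2) ∞ S] :
    Type _ :=
  Bundle.ContMDiffRiemannianMetric (𝓡 2) ∞ Plane (fun x : S => TangentSpace (𝓡 2) x)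

/-- A smooth one-form on `S`: a smooth section of the cotangent bundle. -/
abbrev OneForm (S : Type*) [TopologicalSpace S] [ChartedSpace Plane S] [IsManifold (𝓡 2) ∞ S] :
    Type _ :=
  ContMDiffSection (𝓡 2) (Plane →L[ℝ] ℝ) ∞ (fun x : S => TangentSpace (𝓡 2) x →L[ℝ] ℝ)

/-- A smooth covariant tensor field of rank two on `S`. -/
abbrev TwoTensor (S : Type*) [TopologicalSpace S] [ChartedSpace Plane S]
    [IsManifold (𝓡 2) ∞ S] : Type _ :=
  ContMDiffSection (𝓡 2) (Plane →L[ℝ] Plane →L[ℝ] ℝ) ∞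
    (fun x : S => TangentSpace (𝓡 2) x →L[ℝ] TangentSpace (𝓡 2) x →L[ℝ] ℝ)

/-! ### Coordinate expressions

`c : S` names the chart `extChartAt (𝓡 2) c` around the point `c`, and `y` is a point of the plane,
in the target of that chart. -/

/-- The partial derivative `∂_i f` of a function on the plane. -/
def pderiv (i : Fin 2) (f : Plane → ℝ) (y : Plane) : ℝ :=
  fderiv ℝ f y (EuclideanSpace.single i 1)

variable {S : Type*} [TopologicalSpace S] [ChartedSpace Plane S]

/-- The coordinate vector field `∂_i` of the chart around `c`, at the point with coordinates `y`. -/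
def coordVec (c : S) (y : Plane) (i : Fin 2) :
    TangentSpace (𝓡 2) ((extChartAt (𝓡 2) c).symm y) :=
  mfderiv (𝓡 2) (𝓡 2) (extChartAt (𝓡 2) c).symm y
    (EuclideanSpace.single i 1 : Plane)

variable [IsManifold (𝓡 2) ∞ S]

/-- The matrix of components `g_{ij}` of the metric. -/
def gram (g : Metric S) (c : S) (y : Plane) : Matrix (Fin 2) (Fin 2) ℝ :=
  Matrix.of fun i j => g.inner ((extChartAt (𝓡 2) c).symm y) (coordVec c y i) (coordVec c y j)

/-- The components `g^{ij}` of the inverse metric. -/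
def gramInv (g : Metric S) (c : S) (y : Plane) : Matrix (Fin 2) (Fin 2) ℝ :=
  (gram g c y)⁻¹

/-- The Christoffel symbols `Γ^k_{ij}` of the Levi-Civita connection. -/
def christoffel (g : Metric S) (c : S) (k i j : Fin 2) (y : Plane) : ℝ :=
  (1 / 2) * ∑ l, gramInv g c y k l *
    (pderiv i (fun z => gram g c z j l) y + pderiv j (fun z => gram g c z i l) y
      - pderiv l (fun z => gram g c z i j) y)

/-- The components `R^l_{kij}` of the curvature tensor, `R(∂_i, ∂_j) ∂_k = R^l_{kij} ∂_l`, where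
`R(X, Y) = ∇_X ∇_Y - ∇_Y ∇_X - ∇_{[X, Y]}`. -/
def riemann (g : Metric S) (c : S) (l k i j : Fin 2) (y : Plane) : ℝ :=
  pderiv i (christoffel g c l j k) y - pderiv j (christoffel g c l i k) y
    + ∑ m, (christoffel g c l i m y * christoffel g c m j k y
      - christoffel g c l j m y * christoffel g c m i k y)

/-- The components `β_i` of a one-form. -/
def OneForm.comp (β : OneForm S) (c : S) (i : Fin 2) (y : Plane) : ℝ :=
  β ((extChartAt (𝓡 2) c).symm y) (coordVec c y i)

/-- The components `Z_{ij}` of a rank two tensor field. -/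
def TwoTensor.comp (Z : TwoTensor S) (c : S) (i j : Fin 2) (y : Plane) : ℝ :=
  Z ((extChartAt (𝓡 2) c).symm y) (coordVec c y i) (coordVec c y j)

/-- The components `∇_i β_j` of the covariant derivative of a one-form. -/
def OneForm.covComp (g : Metric S) (β : OneForm S) (c : S) (i j : Fin 2) (y : Plane) : ℝ :=
  pderiv i (β.comp c j) y - ∑ k, christoffel g c k i j y * β.comp c k y

/-- The components `∇_i Z_{jk}` of the covariant derivative of a rank two tensor field. -/
def TwoTensor.covComp (g : Metric S) (Z : TwoTensor S) (c : S) (i j k : Fin 2) (y : Plane) : ℝ :=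
  pderiv i (Z.comp c j k) y
    - ∑ l, (christoffel g c l i j y * Z.comp c l k y + christoffel g c l i k y * Z.comp c j l y)

/-! ### Tensors and scalars at a point

At a point `p` everything is evaluated in the chart around `p` itself. The scalars below are full
contractions, so that they do not depend on the chart. -/

/-- The coordinates of `p` in the chart around `p`. -/
def coord (p : S) : Plane := extChartAt (𝓡 2) p p

/-- The inverse metric `g^{AB}` at `p`. -/
def metInv (g : Metric S) (p : S) : Matrix (Fin 2) (Fin 2) ℝ := gramInv g p (coord p)

/-- The Gauss curvature `k̂ = ⟨R(∂₀, ∂₁) ∂₁, ∂₀⟩ / det (g_{ij})`. -/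
def gaussCurvature (g : Metric S) (p : S) : ℝ :=
  (∑ l, gram g p (coord p) 0 l * riemann g p l 1 0 1 (coord p)) / (gram g p (coord p)).det

/-- `β_A` at `p`. -/
def OneForm.val (β : OneForm S) (p : S) (a : Fin 2) : ℝ := β.comp p a (coord p)

/-- `∇_A β_B` at `p`. -/
def OneForm.cov (g : Metric S) (β : OneForm S) (p : S) (a b : Fin 2) : ℝ :=
  β.covComp g p a b (coord p)

/-- The curl `∇_A β_B - ∇_B β_A` at `p`. -/
def OneForm.curl (g : Metric S) (β : OneForm S) (p : S) (a b : Fin 2) : ℝ :=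
  β.cov g p a b - β.cov g p b a

/-- The divergence `∇^A β_A`. -/
def OneForm.div (g : Metric S) (β : OneForm S) (p : S) : ℝ :=
  ∑ a, ∑ b, metInv g p a b * β.cov g p a b

/-- `Z_{AB}` at `p`. -/
def TwoTensor.val (Z : TwoTensor S) (p : S) (a b : Fin 2) : ℝ := Z.comp p a b (coord p)

/-- `∇_A Z_{BC}` at `p`. -/
def TwoTensor.cov (g : Metric S) (Z : TwoTensor S) (p : S) (a b c : Fin 2) : ℝ :=
  Z.covComp g p a b c (coord p)

/-- The divergence `∇^C Z_{CA}` at `p`. -/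
def TwoTensor.div (g : Metric S) (Z : TwoTensor S) (p : S) (a : Fin 2) : ℝ :=
  ∑ c, ∑ d, metInv g p c d * Z.cov g p c d a

/-- `Z_{AB} = Z_{BA}`. -/
def TwoTensor.IsSymmetric (Z : TwoTensor S) : Prop :=
  ∀ (p : S) (u v : TangentSpace (𝓡 2) p), Z p u v = Z p v u

/-- `g^{AB} Z_{AB} = 0`. -/
def TwoTensor.IsTraceFree (g : Metric S) (Z : TwoTensor S) : Prop :=
  ∀ p : S, ∑ a, ∑ b, metInv g p a b * Z.val p a b = 0

/-- The squared length `g^{AB} v_A v_B` of the components of a covector at `p`. -/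
def normSq₁ (g : Metric S) (p : S) (v : Fin 2 → ℝ) : ℝ :=
  ∑ a, ∑ b, metInv g p a b * v a * v b

/-- The full contraction `g^{AC} g^{BD} T_{AB} T_{CD}` of a rank two tensor at `p` with itself. -/
def normSq₂ (g : Metric S) (p : S) (T : Fin 2 → Fin 2 → ℝ) : ℝ :=
  ∑ a, ∑ b, ∑ c, ∑ d, metInv g p a c * metInv g p b d * T a b * T c d

/-- The full contraction of a rank three tensor at `p` with itself. -/
def normSq₃ (g : Metric S) (p : S) (T : Fin 2 → Fin 2 → Fin 2 → ℝ) : ℝ :=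
  ∑ a, ∑ b, ∑ c, ∑ d, ∑ e, ∑ f,
    metInv g p a d * metInv g p b e * metInv g p c f * T a b c * T d e f

/-- The Riemannian area measure, the measure that integrates functions against the volume form:
the supremum (that is, the gluing) of the measures `√(det g_{ij}) dy` on the chart domains. These
agree on overlaps, so the supremum restricts to each of them on its chart domain. -/
def area [MeasurableSpace S] (g : Metric S) : Measure S :=
  ⨆ c : S, Measure.map (extChartAt (𝓡 2) c).symm
    ((volume.restrict (extChartAt (𝓡 2) c).target).withDensity
      fun y => ENNReal.ofReal (Real.sqrt (gram g c y).det))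

end Surface

end

/-!
Both integral identities are pointwise Bochner formulas followed by the divergence theorem.

For a one-form `β`, the difference of the two integrands is `∇_A β_B ∇^B β^A - (div β)² + k̂ |β|²`,
and this is the divergence of the one-form `β^A ∇_A β_B - β_B div β`: the second derivatives of `β`
enter that divergence only through a commutator, which the Ricci identity turns into curvature, and
in dimension two the curvature tensor has the single component `k̂ det g` (`bochner₁`). For a
symmetric trace-free `Z` one uses `Z^{BC} ∇_B Z_{AC} - Z_A{}^B ∇^C Z_{CB}` in the same way; here the
antisymmetric part of `∇_A Z_{BC}` in `A`, `B` is determined by its trace, the divergence of `Z`,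
because two-forms on a plane have one component (`bochner₂`). Both formulas hold in every
coordinate chart and are polynomial identities in the components once partial derivatives have been
replaced by covariant ones.

The scalars of the statement are evaluated at each point in the chart around that point. That they
are continuous functions follows from the transformation laws between charts. The law of the
Christoffel symbols (`christoffel_transform`) shows that covariant derivatives of tensor fields are
tensor fields, so it suffices to treat families of components, one for each chart, that transform
as tensors (`IsCovector`, `IsTensor₂`, `IsTensor₃`). The transformation law of the curvature is not
needed: the integrand with the curvature is the sum of a first-order scalar and the divergence of a
one-form, and both of these are seen to be invariant.

The area measure restricts to `√(det g) dy` on each chart domain, by the change of variables formula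
(`area_restrict_source`). With a partition of unity, the divergence theorem
(`integral_divergence_eq_zero`) reduces to the vanishing of the integral of a partial derivative of
a compactly supported function on the plane.

If `k̂ > 0` and the right-hand side vanishes, the left-hand integrand is a nonnegative continuous
function with integral zero, hence zero, and so the tensor field is zero.
-/

noncomputable section

namespace Surface

/-! ### Coordinate changes -/

section Coordinates

variable {S : Type*} [TopologicalSpace S] [ChartedSpace Plane S]

/-- The set of points of the chart around `c` whose image in `S` lies in the chart around `d`. -/
def overlap (c d : S) : Set Plane :=
  (extChartAt (𝓡 2) c).target ∩ (extChartAt (𝓡 2) c).symm ⁻¹' (extChartAt (𝓡 2) d).source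

/-- The transition map from the chart around `c` to the chart around `d`. -/
def trans (c d : S) (y : Plane) : Plane :=
  extChartAt (𝓡 2) d ((extChartAt (𝓡 2) c).symm y)

/-- The entry `∂_i τ^a` of the Jacobian matrix of the transition map `τ = trans c d`. -/
def jac (c d : S) (a i : Fin 2) (y : Plane) : ℝ := pderiv i (fun z => trans c d z a) y

theorem isOpen_target (c : S) : IsOpen (extChartAt (𝓡 2) c).target :=
  isOpen_extChartAt_target c

theorem isOpen_overlap (c d : S) : IsOpen (overlap c d) :=
  (continuousOn_extChartAt_symm c).isOpen_inter_preimage (isOpen_target c)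
    (isOpen_extChartAt_source d)

theorem trans_mem_target {c d : S} {y : Plane} (hy : y ∈ overlap c d) :
    trans c d y ∈ (extChartAt (𝓡 2) d).target :=
  (extChartAt (𝓡 2) d).map_source hy.2

theorem symm_trans {c d : S} {y : Plane} (hy : y ∈ overlap c d) :
    (extChartAt (𝓡 2) d).symm (trans c d y) = (extChartAt (𝓡 2) c).symm y :=
  (extChartAt (𝓡 2) d).left_inv hy.2

theorem trans_trans {c d : S} {y : Plane} (hy : y ∈ overlap c d) :
    trans d c (trans c d y) = y := by
  rw [trans, symm_trans hy, (extChartAt (𝓡 2) c).right_inv hy.1]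

variable [IsManifold (𝓡 2) ∞ S]

theorem contDiffOn_trans (c d : S) : ContDiffOn ℝ ∞ (trans c d) (overlap c d) := by
  rw [← contMDiffOn_iff_contDiffOn]
  refine (contMDiffOn_extChartAt (I := 𝓡 2) (n := ∞) (x := d)).comp
    ((contMDiffOn_extChartAt_symm (I := 𝓡 2) (n := ∞) c).mono fun y hy => hy.1) fun y hy => ?_
  simpa using hy.2

theorem mdifferentiableAt_symm {c : S} {y : Plane} (hy : y ∈ (extChartAt (𝓡 2) c).target) :
    MDifferentiableAt (𝓡 2) (𝓡 2) (extChartAt (𝓡 2) c).symm y :=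
  ((contMDiffOn_extChartAt_symm (I := 𝓡 2) (n := ∞) c).contMDiffAt
    ((isOpen_target c).mem_nhds hy)).mdifferentiableAt (by simp)

theorem differentiableAt_trans {c d : S} {y : Plane} (hy : y ∈ overlap c d) :
    DifferentiableAt ℝ (trans c d) y :=
  ((contDiffOn_trans c d).contDiffAt ((isOpen_overlap c d).mem_nhds hy)).differentiableAt (by simp)

theorem fderiv_trans_single {c d : S} {y : Plane} (hy : y ∈ overlap c d) (i : Fin 2) :
    fderiv ℝ (trans c d) y (EuclideanSpace.single i 1)
      = ∑ a, jac c d a i y • EuclideanSpace.single a (1 : ℝ) := by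
  have h : ∀ a, jac c d a i y = fderiv ℝ (trans c d) y (EuclideanSpace.single i 1) a := by
    intro a
    have := ((EuclideanSpace.proj a : Plane →L[ℝ] ℝ).hasFDerivAt.comp y
      (differentiableAt_trans hy).hasFDerivAt).fderiv
    simp only [jac, pderiv]
    erw [this]
    rfl
  ext b
  fin_cases b <;> simp [h, Fin.sum_univ_two]

/-- The derivative of the inverse chart at `y`. The tangent space of `S` at the image of `y` is
identified with the plane, to which it is definitionally equal, so that derivatives at points that
are only propositionally equal can be compared. -/
def frame (c : S) (y : Plane) : Plane →L[ℝ] Plane :=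
  mfderiv (𝓡 2) (𝓡 2) (extChartAt (𝓡 2) c).symm y

/-- The chain rule for the inverse charts. -/
theorem frame_trans {c d : S} {y : Plane} (hy : y ∈ overlap c d) :
    frame c y = (frame d (trans c d y)).comp (fderiv ℝ (trans c d) y) := by
  have h1 : HasMFDerivAt (𝓡 2) (𝓡 2) (extChartAt (𝓡 2) d).symm (trans c d y) _ :=
    (mdifferentiableAt_symm (trans_mem_target hy)).hasMFDerivAt
  have h2 : HasMFDerivAt (𝓡 2) (𝓡 2) (trans c d) y (fderiv ℝ (trans c d) y) :=
    (differentiableAt_trans hy).hasFDerivAt.hasMFDerivAt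
  have h3 := h1.comp y h2
  have h4 := h3.congr_of_eventuallyEq (f₁ := (extChartAt (𝓡 2) c).symm) (by
    filter_upwards [(isOpen_overlap c d).mem_nhds hy] with z hz
    exact (symm_trans hz).symm)
  exact h4.mfderiv

/-- Coordinate vector fields transform by the Jacobian matrix of the transition map. -/
theorem frame_trans_single {c d : S} {y : Plane} (hy : y ∈ overlap c d) (i : Fin 2) :
    frame c y (EuclideanSpace.single i 1)
      = ∑ a, jac c d a i y • frame d (trans c d y) (EuclideanSpace.single a 1) := by
  rw [frame_trans hy, ContinuousLinearMap.comp_apply, fderiv_trans_single hy,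
    map_sum]
  exact Finset.sum_congr rfl fun a _ => map_smul _ _ _

theorem bijective_frame {c : S} {y : Plane} (hy : y ∈ (extChartAt (𝓡 2) c).target) :
    Function.Bijective (frame c y) := by
  have := isInvertible_mfderivWithin_extChartAt_symm (I := 𝓡 2) (x := c) hy
  simp only [modelWithCornersSelf_coe, Set.range_id, mfderivWithin_univ] at this
  obtain ⟨e, he⟩ := this
  have : (frame c y : Plane → Plane) = e := by
    have := congrArg (fun f : Plane →L[ℝ] Plane => (f : Plane → Plane)) he
    exact this.symm
  rw [this]
  exact e.bijective

/-- Coordinate vector fields are smooth sections of the tangent bundle along the inverse chart. -/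
theorem contMDiffOn_coordVec (c : S) (i : Fin 2) :
    ContMDiffOn (𝓡 2) (𝓡 2).tangent ∞
      (fun y => Bundle.TotalSpace.mk' Plane (E := (TangentSpace (𝓡 2) : S → Type _))
        ((extChartAt (𝓡 2) c).symm y) (coordVec c y i)) (extChartAt (𝓡 2) c).target := by
  have h1 := (contMDiffOn_extChartAt_symm (I := 𝓡 2) (n := ∞) c).contMDiffOn_tangentMapWithin
    (m := ∞) (by simp) (isOpen_target c).uniqueMDiffOn
  have h2 : ContMDiff (𝓡 2) (𝓡 2).tangent ∞ (fun y : Plane =>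
      (⟨y, EuclideanSpace.single i 1⟩ : TangentBundle (𝓡 2) Plane)) := by
    have := contMDiff_vectorSpace_iff_contDiff (𝕜 := ℝ) (E := Plane) (n := ∞)
      (V := fun _ => (EuclideanSpace.single i 1 : Plane))
    exact this.2 contDiff_const
  have h3 := h1.comp (s := (extChartAt (𝓡 2) c).target) h2.contMDiffOn (fun y hy => hy)
  refine h3.congr fun y hy => ?_
  simp only [Function.comp, tangentMapWithin]
  rw [mfderivWithin_of_isOpen (isOpen_target c) hy]
  rfl

end Coordinates

/-! ### Components of tensor fields -/

section Tensors

variable {S : Type*} [TopologicalSpace S] [ChartedSpace Plane S]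

/-- A family of functions `f c` on the charts that are the expressions of one smooth function. -/
structure IsScalar (f : S → Plane → ℝ) : Prop where
  smooth : ∀ c, ContDiffOn ℝ ∞ (f c) (extChartAt (𝓡 2) c).target
  transform : ∀ c d, ∀ y ∈ overlap c d, f c y = f d (trans c d y)

/-- A family `w c i` of functions on the charts that are the components `w_i` of one smooth
one-form. -/
structure IsCovector (w : S → Fin 2 → Plane → ℝ) : Prop where
  smooth : ∀ c i, ContDiffOn ℝ ∞ (w c i) (extChartAt (𝓡 2) c).target
  transform : ∀ c d, ∀ y ∈ overlap c d, ∀ i,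
    w c i y = ∑ a, jac c d a i y * w d a (trans c d y)

/-- A family `w c i j` of functions on the charts that are the components `w_{ij}` of one smooth
covariant tensor field of rank two. -/
structure IsTensor₂ (w : S → Fin 2 → Fin 2 → Plane → ℝ) : Prop where
  smooth : ∀ c i j, ContDiffOn ℝ ∞ (w c i j) (extChartAt (𝓡 2) c).target
  transform : ∀ c d, ∀ y ∈ overlap c d, ∀ i j,
    w c i j y = ∑ a, ∑ b, jac c d a i y * jac c d b j y * w d a b (trans c d y)

/-- A family `w c i j k` of functions on the charts that are the components `w_{ijk}` of one
smooth covariant tensor field of rank three. -/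
structure IsTensor₃ (w : S → Fin 2 → Fin 2 → Fin 2 → Plane → ℝ) : Prop where
  smooth : ∀ c i j k, ContDiffOn ℝ ∞ (w c i j k) (extChartAt (𝓡 2) c).target
  transform : ∀ c d, ∀ y ∈ overlap c d, ∀ i j k,
    w c i j k y = ∑ a, ∑ b, ∑ e, jac c d a i y * jac c d b j y * jac c d e k y *
      w d a b e (trans c d y)

variable [IsManifold (𝓡 2) ∞ S]

theorem OneForm.isCovector_comp (β : OneForm S) : IsCovector β.comp where
  smooth c i := by
    have h1 := (β.contMDiff.contMDiffOn (s := Set.univ)).comp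
      (contMDiffOn_extChartAt_symm (I := 𝓡 2) (n := ∞) c) (fun y _ => Set.mem_univ _)
    have h2 := ContMDiffOn.clm_bundle_apply (F₁ := Plane) (F₂ := ℝ)
      (E₂ := Bundle.Trivial S ℝ) h1 (contMDiffOn_coordVec c i)
    intro y hy
    have h3 := h2 y hy
    rw [Bundle.contMDiffWithinAt_totalSpace] at h3
    exact contMDiffWithinAt_iff_contDiffWithinAt.1 h3.2
  transform c d y hy i := by
    let B : S → Plane →L[ℝ] ℝ := fun p => β p
    change B _ (frame c y (EuclideanSpace.single i 1)) = ∑ a, jac c d a i y *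
      B _ (frame d (trans c d y) (EuclideanSpace.single a 1))
    rw [symm_trans hy, frame_trans_single hy, map_sum]
    simp only [map_smul, smul_eq_mul]

/-- The components of a smooth section of the bundle of bilinear forms. -/
theorem isTensor₂_bilinear
    (Z : ∀ x : S, TangentSpace (𝓡 2) x →L[ℝ] TangentSpace (𝓡 2) x →L[ℝ] ℝ)
    (hZ : ContMDiff (𝓡 2) ((𝓡 2).prod 𝓘(ℝ, Plane →L[ℝ] Plane →L[ℝ] ℝ)) ∞
      (fun x => Bundle.TotalSpace.mk' (Plane →L[ℝ] Plane →L[ℝ] ℝ) x (Z x))) :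
    IsTensor₂ (fun (c : S) i j y =>
      Z ((extChartAt (𝓡 2) c).symm y) (coordVec c y i) (coordVec c y j)) where
  smooth c i j := by
    have h1 := (hZ.contMDiffOn (s := Set.univ)).comp
      (contMDiffOn_extChartAt_symm (I := 𝓡 2) (n := ∞) c) (fun y _ => Set.mem_univ _)
    have h2 := ContMDiffOn.clm_bundle_apply₂ (F₁ := Plane) (F₂ := Plane) (F₃ := ℝ)
      (E₃ := Bundle.Trivial S ℝ) h1 (contMDiffOn_coordVec c i) (contMDiffOn_coordVec c j)
    intro y hy
    have h3 := h2 y hy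
    rw [Bundle.contMDiffWithinAt_totalSpace] at h3
    exact contMDiffWithinAt_iff_contDiffWithinAt.1 h3.2
  transform c d y hy i j := by
    let B : S → Plane →L[ℝ] Plane →L[ℝ] ℝ := fun p => Z p
    change B _ (frame c y (EuclideanSpace.single i 1)) (frame c y (EuclideanSpace.single j 1))
      = ∑ a, ∑ b, jac c d a i y * jac c d b j y *
        B _ (frame d (trans c d y) (EuclideanSpace.single a 1))
          (frame d (trans c d y) (EuclideanSpace.single b 1))
    rw [symm_trans hy, frame_trans_single hy i, frame_trans_single hy j]
    simp only [Fin.sum_univ_two, map_add, map_smul, add_apply, smul_apply, smul_eq_mul]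
    ring

theorem TwoTensor.isTensor₂_comp (Z : TwoTensor S) : IsTensor₂ Z.comp :=
  isTensor₂_bilinear (fun x => Z x) Z.contMDiff

theorem isTensor₂_gram (g : Metric S) : IsTensor₂ (fun c i j y => gram g c y i j) :=
  isTensor₂_bilinear (fun x => g.inner x) g.contMDiff

/-! ### The metric in a chart -/

theorem gram_symm (g : Metric S) (c : S) (y : Plane) (i j : Fin 2) :
    gram g c y i j = gram g c y j i := g.symm _ _ _

theorem gram_quadratic_pos (g : Metric S) {c : S} {y : Plane}
    (hy : y ∈ (extChartAt (𝓡 2) c).target) {a b : ℝ} (hab : a ≠ 0 ∨ b ≠ 0) :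
    0 < a ^ 2 * gram g c y 0 0 + 2 * a * b * gram g c y 0 1 + b ^ 2 * gram g c y 1 1 := by
  set v : Plane := a • EuclideanSpace.single 0 (1 : ℝ) + b • EuclideanSpace.single 1 (1 : ℝ) with hv
  have hv0 : v ≠ 0 := by
    intro h
    have h0 := congrArg (fun w : Plane => w 0) h
    have h1 := congrArg (fun w : Plane => w 1) h
    simp [hv] at h0 h1
    tauto
  have hf : frame c y v ≠ 0 := fun h =>
    hv0 ((bijective_frame hy).1 (by rw [h, map_zero]))
  have hpos := g.pos ((extChartAt (𝓡 2) c).symm y) (frame c y v) hf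
  let B : Plane →L[ℝ] Plane →L[ℝ] ℝ := g.inner ((extChartAt (𝓡 2) c).symm y)
  have hB : ∀ i j, gram g c y i j
    = B (frame c y (EuclideanSpace.single i 1)) (frame c y (EuclideanSpace.single j 1)) :=
    fun i j => rfl
  change 0 < B (frame c y v) (frame c y v) at hpos
  have hs : B (frame c y (EuclideanSpace.single 1 1)) (frame c y (EuclideanSpace.single 0 1))
    = B (frame c y (EuclideanSpace.single 0 1)) (frame c y (EuclideanSpace.single 1 1)) :=
    gram_symm g c y 1 0
  simp only [hv, map_add, map_smul, add_apply, smul_apply,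
    smul_eq_mul, hs] at hpos
  simp only [hB]
  linarith

theorem gram_det (g : Metric S) (c : S) (y : Plane) :
    (gram g c y).det = gram g c y 0 0 * gram g c y 1 1 - gram g c y 0 1 ^ 2 := by
  rw [Matrix.det_fin_two, gram_symm g c y 1 0]; ring

theorem gram_det_pos (g : Metric S) {c : S} {y : Plane}
    (hy : y ∈ (extChartAt (𝓡 2) c).target) : 0 < (gram g c y).det := by
  have h1 := gram_quadratic_pos g hy (a := 0) (b := 1) (by simp)
  have h1' : 0 < gram g c y 1 1 := by linarith
  have h2 := gram_quadratic_pos g hy (a := gram g c y 1 1) (b := - gram g c y 0 1)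
    (Or.inl h1'.ne')
  have h3 : 0 < gram g c y 1 1 * (gram g c y).det := by rw [gram_det]; linarith
  exact pos_of_mul_pos_right h3 h1'.le

theorem gramInv_eq (g : Metric S) (c : S) (y : Plane) :
    gramInv g c y = !![gram g c y 1 1 / (gram g c y).det, -gram g c y 0 1 / (gram g c y).det;
      -gram g c y 0 1 / (gram g c y).det, gram g c y 0 0 / (gram g c y).det] := by
  rw [gramInv, Matrix.inv_def, Matrix.adjugate_fin_two, gram_symm g c y 1 0, Ring.inverse_eq_inv']
  ext i j
  fin_cases i <;> fin_cases j <;> simp [div_eq_inv_mul]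

theorem gramInv_symm (g : Metric S) (c : S) (y : Plane) (i j : Fin 2) :
    gramInv g c y i j = gramInv g c y j i := by
  rw [gramInv_eq]
  fin_cases i <;> fin_cases j <;> rfl

theorem gramInv_mul_gram (g : Metric S) {c : S} {y : Plane}
    (hy : y ∈ (extChartAt (𝓡 2) c).target) : gramInv g c y * gram g c y = 1 :=
  Matrix.nonsing_inv_mul _ (isUnit_iff_ne_zero.2 (gram_det_pos g hy).ne')

theorem contDiffOn_gram (g : Metric S) (c : S) (i j : Fin 2) :
    ContDiffOn ℝ ∞ (fun y => gram g c y i j) (extChartAt (𝓡 2) c).target :=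
  (isTensor₂_gram g).smooth c i j

theorem contDiffOn_gram_det (g : Metric S) (c : S) :
    ContDiffOn ℝ ∞ (fun y => (gram g c y).det) (extChartAt (𝓡 2) c).target := by
  simp only [gram_det]
  exact ((contDiffOn_gram g c 0 0).mul (contDiffOn_gram g c 1 1)).sub
    ((contDiffOn_gram g c 0 1).pow 2)

theorem contDiffOn_gramInv (g : Metric S) (c : S) (i j : Fin 2) :
    ContDiffOn ℝ ∞ (fun y => gramInv g c y i j) (extChartAt (𝓡 2) c).target := by
  have hd : ∀ y ∈ (extChartAt (𝓡 2) c).target, (gram g c y).det ≠ 0 :=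
    fun y hy => (gram_det_pos g hy).ne'
  simp only [gramInv_eq]
  fin_cases i <;> fin_cases j
  · exact (contDiffOn_gram g c 1 1).div (contDiffOn_gram_det g c) hd
  · exact (contDiffOn_gram g c 0 1).neg.div (contDiffOn_gram_det g c) hd
  · exact (contDiffOn_gram g c 0 1).neg.div (contDiffOn_gram_det g c) hd
  · exact (contDiffOn_gram g c 0 0).div (contDiffOn_gram_det g c) hd

end Tensors

/-! ### Partial derivatives -/

theorem pderiv_congr {i : Fin 2} {f f' : Plane → ℝ} {y : Plane} (h : f =ᶠ[nhds y] f') :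
    pderiv i f y = pderiv i f' y := by
  rw [pderiv, pderiv, h.fderiv_eq]

theorem pderiv_add {i : Fin 2} {f f' : Plane → ℝ} {y : Plane} (hf : DifferentiableAt ℝ f y)
    (hf' : DifferentiableAt ℝ f' y) :
    pderiv i (fun z => f z + f' z) y = pderiv i f y + pderiv i f' y := by
  rw [pderiv, fderiv_fun_add hf hf']; rfl

theorem pderiv_sub {i : Fin 2} {f f' : Plane → ℝ} {y : Plane} (hf : DifferentiableAt ℝ f y)
    (hf' : DifferentiableAt ℝ f' y) :
    pderiv i (fun z => f z - f' z) y = pderiv i f y - pderiv i f' y := by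
  rw [pderiv, fderiv_fun_sub hf hf']; rfl

theorem pderiv_mul {i : Fin 2} {f f' : Plane → ℝ} {y : Plane} (hf : DifferentiableAt ℝ f y)
    (hf' : DifferentiableAt ℝ f' y) :
    pderiv i (fun z => f z * f' z) y = pderiv i f y * f' y + f y * pderiv i f' y := by
  rw [pderiv, fderiv_fun_mul hf hf']
  simp only [pderiv, add_apply, smul_apply, smul_eq_mul]
  ring

theorem pderiv_sum {ι : Type*} {s : Finset ι} {i : Fin 2} {f : ι → Plane → ℝ} {y : Plane}
    (hf : ∀ a ∈ s, DifferentiableAt ℝ (f a) y) :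
    pderiv i (fun z => ∑ a ∈ s, f a z) y = ∑ a ∈ s, pderiv i (f a) y := by
  rw [pderiv, fderiv_fun_sum hf, sum_apply]; rfl

theorem pderiv_const {i : Fin 2} (r : ℝ) (y : Plane) : pderiv i (fun _ => r) y = 0 := by
  simp [pderiv]

theorem contDiffOn_pderiv {i : Fin 2} {f : Plane → ℝ} {s : Set Plane} (hs : IsOpen s)
    (hf : ContDiffOn ℝ ∞ f s) : ContDiffOn ℝ ∞ (pderiv i f) s :=
  (hf.fderiv_of_isOpen hs (m := ∞) (by simp)).clm_apply contDiffOn_const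

theorem differentiableAt_of_contDiffOn {f : Plane → ℝ} {s : Set Plane} (hs : IsOpen s)
    (hf : ContDiffOn ℝ ∞ f s) {y : Plane} (hy : y ∈ s) : DifferentiableAt ℝ f y :=
  (hf.contDiffAt (hs.mem_nhds hy)).differentiableAt (by simp)

theorem pderiv_comm {i j : Fin 2} {f : Plane → ℝ} {s : Set Plane} (hs : IsOpen s)
    (hf : ContDiffOn ℝ ∞ f s) {y : Plane} (hy : y ∈ s) :
    pderiv i (pderiv j f) y = pderiv j (pderiv i f) y := by
  have hd : DifferentiableAt ℝ (fderiv ℝ f) y :=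
    ((hf.fderiv_of_isOpen hs (m := ∞) (by simp)).contDiffAt (hs.mem_nhds hy)).differentiableAt
      (by simp)
  have key : ∀ k l : Fin 2, pderiv k (pderiv l f) y
      = fderiv ℝ (fderiv ℝ f) y (EuclideanSpace.single k 1) (EuclideanSpace.single l 1) := by
    intro k l
    have h := fderiv_clm_apply hd (differentiableAt_const (EuclideanSpace.single l (1 : ℝ)))
    change fderiv ℝ (fun z => fderiv ℝ f z (EuclideanSpace.single l 1)) y _ = _
    rw [h]
    simp
  rw [key, key]
  exact ((hf.contDiffAt (hs.mem_nhds hy)).isSymmSndFDerivAt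
    (by rw [minSmoothness_of_isRCLikeNormedField]; exact WithTop.coe_le_coe.2 (le_top : (2 : ℕ∞) ≤ ⊤))).eq _ _

section Transition

variable {S : Type*} [TopologicalSpace S] [ChartedSpace Plane S] [IsManifold (𝓡 2) ∞ S]

theorem pderiv_comp_trans {c d : S} {y : Plane} (hy : y ∈ overlap c d) (k : Fin 2)
    {f : Plane → ℝ} (hf : DifferentiableAt ℝ f (trans c d y)) :
    pderiv k (fun z => f (trans c d z)) y = ∑ b, jac c d b k y * pderiv b f (trans c d y) := by
  have h := (hf.hasFDerivAt.comp y (differentiableAt_trans hy).hasFDerivAt).fderiv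
  change fderiv ℝ (f ∘ trans c d) y _ = _
  rw [h, ContinuousLinearMap.comp_apply, fderiv_trans_single hy, map_sum]
  simp only [map_smul, smul_eq_mul]
  rfl

theorem contDiffOn_trans_apply (c d : S) (a : Fin 2) :
    ContDiffOn ℝ ∞ (fun z => trans c d z a) (overlap c d) :=
  (EuclideanSpace.proj a : Plane →L[ℝ] ℝ).contDiff.comp_contDiffOn (contDiffOn_trans c d)

theorem contDiffOn_jac (c d : S) (a i : Fin 2) :
    ContDiffOn ℝ ∞ (jac c d a i) (overlap c d) :=
  contDiffOn_pderiv (isOpen_overlap c d) (contDiffOn_trans_apply c d a)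

theorem differentiableAt_jac {c d : S} {y : Plane} (hy : y ∈ overlap c d) (a i : Fin 2) :
    DifferentiableAt ℝ (jac c d a i) y :=
  differentiableAt_of_contDiffOn (isOpen_overlap c d) (contDiffOn_jac c d a i) hy

/-- The second derivative `∂_k ∂_i τ^a` of the transition map. -/
def hess (c d : S) (a k i : Fin 2) (y : Plane) : ℝ := pderiv k (jac c d a i) y

theorem hess_symm {c d : S} {y : Plane} (hy : y ∈ overlap c d) (a k i : Fin 2) :
    hess c d a k i y = hess c d a i k y :=
  pderiv_comm (isOpen_overlap c d) (contDiffOn_trans_apply c d a) hy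

variable {c d : S} {y : Plane}

omit [IsManifold (𝓡 2) ∞ S] in
theorem IsCovector.differentiableAt {w : S → Fin 2 → Plane → ℝ} (hw : IsCovector w)
    (hy : y ∈ (extChartAt (𝓡 2) c).target) (i : Fin 2) : DifferentiableAt ℝ (w c i) y :=
  differentiableAt_of_contDiffOn (isOpen_target c) (hw.smooth c i) hy

omit [IsManifold (𝓡 2) ∞ S] in
theorem IsTensor₂.differentiableAt {w : S → Fin 2 → Fin 2 → Plane → ℝ} (hw : IsTensor₂ w)
    (hy : y ∈ (extChartAt (𝓡 2) c).target) (i j : Fin 2) : DifferentiableAt ℝ (w c i j) y :=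
  differentiableAt_of_contDiffOn (isOpen_target c) (hw.smooth c i j) hy

theorem IsCovector.pderiv_transform {w : S → Fin 2 → Plane → ℝ} (hw : IsCovector w)
    (hy : y ∈ overlap c d) (k i : Fin 2) :
    pderiv k (w c i) y = ∑ a, (hess c d a k i y * w d a (trans c d y)
      + jac c d a i y * ∑ b, jac c d b k y * pderiv b (w d a) (trans c d y)) := by
  have h1 : w c i =ᶠ[nhds y] fun z => ∑ a, jac c d a i z * w d a (trans c d z) := by
    filter_upwards [(isOpen_overlap c d).mem_nhds hy] with z hz
    exact hw.transform c d z hz i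
  have h2 : ∀ a, DifferentiableAt ℝ (fun z => w d a (trans c d z)) y := fun a =>
    (hw.differentiableAt (trans_mem_target hy) a).comp y (differentiableAt_trans hy)
  rw [pderiv_congr h1, pderiv_sum fun a _ => (differentiableAt_jac hy a i).fun_mul (h2 a)]
  refine Finset.sum_congr rfl fun a _ => ?_
  rw [pderiv_mul (differentiableAt_jac hy a i) (h2 a),
    pderiv_comp_trans hy k (hw.differentiableAt (trans_mem_target hy) a)]
  rfl

theorem IsTensor₂.pderiv_transform {w : S → Fin 2 → Fin 2 → Plane → ℝ} (hw : IsTensor₂ w)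
    (hy : y ∈ overlap c d) (k i j : Fin 2) :
    pderiv k (w c i j) y = ∑ a, ∑ b, ((hess c d a k i y * jac c d b j y
      + jac c d a i y * hess c d b k j y) * w d a b (trans c d y)
      + jac c d a i y * jac c d b j y *
        ∑ e, jac c d e k y * pderiv e (w d a b) (trans c d y)) := by
  have h1 : w c i j =ᶠ[nhds y] fun z =>
      ∑ a, ∑ b, jac c d a i z * jac c d b j z * w d a b (trans c d z) := by
    filter_upwards [(isOpen_overlap c d).mem_nhds hy] with z hz
    exact hw.transform c d z hz i j
  have h2 : ∀ a b, DifferentiableAt ℝ (fun z => w d a b (trans c d z)) y := fun a b =>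
    (hw.differentiableAt (trans_mem_target hy) a b).comp y (differentiableAt_trans hy)
  have hj := differentiableAt_jac hy
  have h3 : ∀ a b, DifferentiableAt ℝ (fun z => jac c d a i z * jac c d b j z) y :=
    fun a b => (hj a i).fun_mul (hj b j)
  rw [pderiv_congr h1, pderiv_sum fun a _ => DifferentiableAt.fun_sum fun b _ =>
    (h3 a b).fun_mul (h2 a b)]
  refine Finset.sum_congr rfl fun a _ => ?_
  rw [pderiv_sum fun b _ => (h3 a b).fun_mul (h2 a b)]
  refine Finset.sum_congr rfl fun b _ => ?_
  rw [pderiv_mul (h3 a b) (h2 a b), pderiv_mul (hj a i) (hj b j),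
    pderiv_comp_trans hy k (hw.differentiableAt (trans_mem_target hy) a b)]
  rfl

/-! ### Transformation of the metric and of the Christoffel symbols -/

/-- The Jacobian matrix of the transition map. -/
def jacMatrix (c d : S) (y : Plane) : Matrix (Fin 2) (Fin 2) ℝ := Matrix.of fun a i => jac c d a i y

theorem gram_transform (g : Metric S) (hy : y ∈ overlap c d) :
    gram g c y = (jacMatrix c d y).transpose * gram g d (trans c d y) * jacMatrix c d y := by
  ext i j
  rw [(isTensor₂_gram g).transform c d y hy i j]
  simp only [Matrix.mul_apply, Fin.sum_univ_two, Matrix.transpose_apply, jacMatrix, Matrix.of_apply]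
  ring

theorem gram_det_transform (g : Metric S) (hy : y ∈ overlap c d) :
    (gram g c y).det = (jacMatrix c d y).det ^ 2 * (gram g d (trans c d y)).det := by
  rw [gram_transform g hy, Matrix.det_mul, Matrix.det_mul, Matrix.det_transpose]; ring

theorem jacMatrix_det_ne_zero (g : Metric S) (hy : y ∈ overlap c d) :
    (jacMatrix c d y).det ≠ 0 := by
  intro h
  have := gram_det_pos g hy.1
  rw [gram_det_transform g hy, h] at this
  simp at this

/-- The inverse metric transforms contravariantly. -/
theorem gramInv_transform (g : Metric S) (hy : y ∈ overlap c d) (a b : Fin 2) :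
    gramInv g d (trans c d y) a b
      = ∑ i, ∑ j, jac c d a i y * jac c d b j y * gramInv g c y i j := by
  have hJ : IsUnit (jacMatrix c d y).det := isUnit_iff_ne_zero.2 (jacMatrix_det_ne_zero g hy)
  have hJt : IsUnit (jacMatrix c d y).transpose.det := by rwa [Matrix.det_transpose]
  have h : gramInv g d (trans c d y)
      = jacMatrix c d y * gramInv g c y * (jacMatrix c d y).transpose := by
    rw [gramInv, gramInv, gram_transform g hy, Matrix.mul_inv_rev, Matrix.mul_inv_rev]
    rw [Matrix.mul_assoc (jacMatrix c d y), Matrix.mul_assoc _ _ (jacMatrix c d y).transpose,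
      Matrix.mul_assoc _ _ (jacMatrix c d y).transpose, Matrix.nonsing_inv_mul _ hJt,
      Matrix.mul_one, ← Matrix.mul_assoc, Matrix.mul_nonsing_inv _ hJ, Matrix.one_mul]
  rw [h]
  simp only [Matrix.mul_apply, Fin.sum_univ_two, Matrix.transpose_apply, jacMatrix, Matrix.of_apply]
  ring

/-- The Christoffel symbols of the first kind, with the index that is raised in front. -/
def christoffelLow (g : Metric S) (c : S) (l i j : Fin 2) (y : Plane) : ℝ :=
  (1 / 2) * (pderiv i (fun z => gram g c z j l) y + pderiv j (fun z => gram g c z i l) y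
      - pderiv l (fun z => gram g c z i j) y)

theorem christoffel_eq_sum_low (g : Metric S) (c : S) (k i j : Fin 2) (y : Plane) :
    christoffel g c k i j y = ∑ l, gramInv g c y k l * christoffelLow g c l i j y := by
  rw [christoffel, Finset.mul_sum]
  exact Finset.sum_congr rfl fun l _ => by rw [christoffelLow]; ring

theorem gram_fun_symm (g : Metric S) (c : S) (i j : Fin 2) :
    (fun y => gram g c y i j) = fun y => gram g c y j i :=
  funext fun y => gram_symm g c y i j

theorem christoffelLow_symm (g : Metric S) (c : S) (l i j : Fin 2) (y : Plane) :
    christoffelLow g c l i j y = christoffelLow g c l j i y := by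
  rw [christoffelLow, christoffelLow, gram_fun_symm g c i j]; ring

theorem christoffel_symm (g : Metric S) (c : S) (k i j : Fin 2) (y : Plane) :
    christoffel g c k i j y = christoffel g c k j i y := by
  simp only [christoffel_eq_sum_low, christoffelLow_symm g c _ i j]

theorem christoffelLow_transform (g : Metric S) (hy : y ∈ overlap c d) (l i j : Fin 2) :
    christoffelLow g c l i j y
      = ∑ a, jac c d a l y * (∑ b, gram g d (trans c d y) a b * hess c d b i j y
        + ∑ b, ∑ e, jac c d b i y * jac c d e j y * christoffelLow g d a b e (trans c d y)) := by
  have h := (isTensor₂_gram g).pderiv_transform hy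
  rw [christoffelLow, h i j l, h j i l, h l i j]
  simp only [christoffelLow, Fin.sum_univ_two, gram_symm g d _ 1 0,
    hess_symm hy _ j i, hess_symm hy _ l i, hess_symm hy _ l j]
  ring

/-- The inhomogeneous transformation law of the Christoffel symbols. -/
theorem christoffel_transform (g : Metric S) (hy : y ∈ overlap c d) (a i j : Fin 2) :
    ∑ k, jac c d a k y * christoffel g c k i j y
      = hess c d a i j y + ∑ b, ∑ e, jac c d b i y * jac c d e j y *
        christoffel g d a b e (trans c d y) := by
  have h1 : ∀ m, ∑ b, gramInv g d (trans c d y) a b * gram g d (trans c d y) b m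
      = (1 : Matrix (Fin 2) (Fin 2) ℝ) a m := by
    intro m
    rw [← gramInv_mul_gram g (trans_mem_target hy), Matrix.mul_apply]
  have h2 : ∑ m, (1 : Matrix (Fin 2) (Fin 2) ℝ) a m * hess c d m i j y = hess c d a i j y := by
    simp [Matrix.one_apply]
  rw [← h2]
  -- raise the index of the law for `christoffelLow`, writing the identity matrix as `h g`
  simp only [christoffel_eq_sum_low, christoffelLow_transform g hy, ← h1]
  simp only [gramInv_transform g hy, Fin.sum_univ_two]
  ring

/-! ### Covariant derivatives -/

/-- The components `∇_i w_j` of the covariant derivative of a one-form given by components. -/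
def covD₁ (g : Metric S) (w : S → Fin 2 → Plane → ℝ) (c : S) (i j : Fin 2) (y : Plane) : ℝ :=
  pderiv i (w c j) y - ∑ k, christoffel g c k i j y * w c k y

/-- The components `∇_i w_{jk}` of the covariant derivative of a tensor field of rank two given by
components. -/
def covD₂ (g : Metric S) (w : S → Fin 2 → Fin 2 → Plane → ℝ) (c : S) (i j k : Fin 2)
    (y : Plane) : ℝ :=
  pderiv i (w c j k) y
    - ∑ l, (christoffel g c l i j y * w c l k y + christoffel g c l i k y * w c j l y)

theorem contDiffOn_christoffel (g : Metric S) (c : S) (k i j : Fin 2) :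
    ContDiffOn ℝ ∞ (christoffel g c k i j) (extChartAt (𝓡 2) c).target := by
  have h : ∀ a i j, ContDiffOn ℝ ∞ (pderiv a (fun z => gram g c z i j))
      (extChartAt (𝓡 2) c).target :=
    fun a i j => contDiffOn_pderiv (isOpen_target c) (contDiffOn_gram g c i j)
  exact contDiffOn_const.mul (ContDiffOn.sum fun l _ =>
    (contDiffOn_gramInv g c k l).mul (((h _ _ _).add (h _ _ _)).sub (h _ _ _)))

/-- The covariant derivative of a one-form is a tensor field. -/
theorem IsCovector.covD₁ (g : Metric S) {w : S → Fin 2 → Plane → ℝ} (hw : IsCovector w) :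
    IsTensor₂ (covD₁ g w) where
  smooth c i j := (contDiffOn_pderiv (isOpen_target c) (hw.smooth c j)).sub
    (ContDiffOn.sum fun k _ => (contDiffOn_christoffel g c k i j).mul (hw.smooth c k))
  transform c d y hy i j := by
    have e := fun a => christoffel_transform g hy a i j
    have e0 := e 0
    have e1 := e 1
    simp only [Surface.covD₁, hw.pderiv_transform hy i j, hw.transform c d y hy, Fin.sum_univ_two]
      at e0 e1 ⊢
    linear_combination (-w d 0 (trans c d y)) * e0 - w d 1 (trans c d y) * e1

/-- The covariant derivative of a tensor field of rank two is a tensor field. -/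
theorem IsTensor₂.covD₂ (g : Metric S) {w : S → Fin 2 → Fin 2 → Plane → ℝ} (hw : IsTensor₂ w) :
    IsTensor₃ (covD₂ g w) where
  smooth c i j k := (contDiffOn_pderiv (isOpen_target c) (hw.smooth c j k)).sub
    (ContDiffOn.sum fun l _ => ((contDiffOn_christoffel g c l i j).mul (hw.smooth c l k)).add
      ((contDiffOn_christoffel g c l i k).mul (hw.smooth c j l)))
  transform c d y hy i j k := by
    have e := christoffel_transform g hy
    have e0 := e 0 i j
    have e1 := e 1 i j
    have f0 := e 0 i k
    have f1 := e 1 i k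
    simp only [Surface.covD₂, hw.pderiv_transform hy i j k, hw.transform c d y hy,
      Fin.sum_univ_two] at e0 e1 f0 f1 ⊢
    linear_combination
      (-w d 0 0 (trans c d y) * jac c d 0 k y - w d 0 1 (trans c d y) * jac c d 1 k y) * e0
      - (w d 1 0 (trans c d y) * jac c d 0 k y + w d 1 1 (trans c d y) * jac c d 1 k y) * e1
      - (w d 0 0 (trans c d y) * jac c d 0 j y + w d 1 0 (trans c d y) * jac c d 1 j y) * f0
      - (w d 0 1 (trans c d y) * jac c d 0 j y + w d 1 1 (trans c d y) * jac c d 1 j y) * f1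

end Transition

/-! ### Compatibility of the connection with the metric -/

section Compatibility

variable {S : Type*} [TopologicalSpace S] [ChartedSpace Plane S] [IsManifold (𝓡 2) ∞ S]
variable {c : S} {y : Plane}

theorem gram_mul_gramInv (g : Metric S) (hy : y ∈ (extChartAt (𝓡 2) c).target) :
    gram g c y * gramInv g c y = 1 :=
  Matrix.mul_nonsing_inv _ (isUnit_iff_ne_zero.2 (gram_det_pos g hy).ne')

theorem sum_gram_mul_gramInv (g : Metric S) (hy : y ∈ (extChartAt (𝓡 2) c).target) (i k : Fin 2) :
    ∑ j, gram g c y i j * gramInv g c y j k = (1 : Matrix (Fin 2) (Fin 2) ℝ) i k := by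
  rw [← gram_mul_gramInv g hy, Matrix.mul_apply]

theorem sum_gramInv_mul_gram (g : Metric S) (hy : y ∈ (extChartAt (𝓡 2) c).target) (i k : Fin 2) :
    ∑ j, gramInv g c y i j * gram g c y j k = (1 : Matrix (Fin 2) (Fin 2) ℝ) i k := by
  rw [← gramInv_mul_gram g hy, Matrix.mul_apply]

theorem sum_gram_christoffel (g : Metric S) (hy : y ∈ (extChartAt (𝓡 2) c).target)
    (l i j : Fin 2) :
    ∑ k, gram g c y l k * christoffel g c k i j y = christoffelLow g c l i j y := by
  have h : christoffelLow g c l i j y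
      = ∑ m, (1 : Matrix (Fin 2) (Fin 2) ℝ) l m * christoffelLow g c m i j y := by
    simp [Matrix.one_apply]
  rw [h]
  simp only [christoffel_eq_sum_low, ← sum_gram_mul_gramInv g hy, Fin.sum_univ_two]
  ring

/-- The metric is parallel. -/
theorem pderiv_gram (g : Metric S) (hy : y ∈ (extChartAt (𝓡 2) c).target) (k i j : Fin 2) :
    pderiv k (fun z => gram g c z i j) y
      = ∑ l, (christoffel g c l k i y * gram g c y l j
        + christoffel g c l k j y * gram g c y i l) := by
  have h1 := sum_gram_christoffel g hy j k i
  have h2 := sum_gram_christoffel g hy i k j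
  rw [christoffelLow] at h1 h2
  simp only [gram_fun_symm g c j i] at h2
  simp only [Fin.sum_univ_two] at h1 h2 ⊢
  rw [gram_symm g c y 0 j, gram_symm g c y 1 j]
  linear_combination - h1 - h2

theorem differentiableAt_gram (g : Metric S) (hy : y ∈ (extChartAt (𝓡 2) c).target)
    (i j : Fin 2) : DifferentiableAt ℝ (fun z => gram g c z i j) y :=
  differentiableAt_of_contDiffOn (isOpen_target c) (contDiffOn_gram g c i j) hy

theorem differentiableAt_gramInv (g : Metric S) (hy : y ∈ (extChartAt (𝓡 2) c).target)
    (i j : Fin 2) : DifferentiableAt ℝ (fun z => gramInv g c z i j) y :=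
  differentiableAt_of_contDiffOn (isOpen_target c) (contDiffOn_gramInv g c i j) hy

theorem differentiableAt_christoffel (g : Metric S) (hy : y ∈ (extChartAt (𝓡 2) c).target)
    (k i j : Fin 2) : DifferentiableAt ℝ (christoffel g c k i j) y :=
  differentiableAt_of_contDiffOn (isOpen_target c) (contDiffOn_christoffel g c k i j) hy

/-- The inverse metric is parallel. -/
theorem pderiv_gramInv (g : Metric S) (hy : y ∈ (extChartAt (𝓡 2) c).target) (k i j : Fin 2) :
    pderiv k (fun z => gramInv g c z i j) y
      = - ∑ l, (christoffel g c i k l y * gramInv g c y l j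
        + christoffel g c j k l y * gramInv g c y i l) := by
  have hI := differentiableAt_gramInv g hy
  have hG := differentiableAt_gram g hy
  set D : Matrix (Fin 2) (Fin 2) ℝ :=
    Matrix.of fun i j => pderiv k (fun z => gramInv g c z i j) y with hD
  set C : Matrix (Fin 2) (Fin 2) ℝ := Matrix.of fun i j => christoffel g c i k j y with hC
  -- differentiate `h g = 1`
  have h1 : D * gram g c y + gramInv g c y * (C.transpose * gram g c y + gram g c y * C) = 0 := by
    ext i m
    have h2 := pderiv_const (i := k) ((1 : Matrix (Fin 2) (Fin 2) ℝ) i m) y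
    rw [← pderiv_congr (f := fun z => ∑ a, gramInv g c z i a * gram g c z a m) (by
        filter_upwards [(isOpen_target c).mem_nhds hy] with z hz
        exact sum_gramInv_mul_gram g hz i m),
      pderiv_sum fun a _ => (hI i a).fun_mul (hG a m)] at h2
    rw [Matrix.add_apply, Matrix.mul_apply, Matrix.mul_apply, ← Finset.sum_add_distrib]
    refine Eq.trans (Finset.sum_congr rfl fun a _ => ?_) h2
    rw [pderiv_mul (hI i a) (hG a m), pderiv_gram g hy, Matrix.add_apply, Matrix.mul_apply,
      Matrix.mul_apply, ← Finset.sum_add_distrib]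
    simp only [hD, hC, Matrix.of_apply, Matrix.transpose_apply, Fin.sum_univ_two]
    ring
  have h3 : D = -(C * gramInv g c y + gramInv g c y * C.transpose) := by
    have h4 := congrArg (· * gramInv g c y) h1
    simp only [Matrix.add_mul, Matrix.mul_add, Matrix.mul_assoc, gram_mul_gramInv g hy,
      Matrix.mul_one, Matrix.zero_mul] at h4
    rw [← Matrix.mul_assoc (gramInv g c y) (gram g c y), gramInv_mul_gram g hy, Matrix.one_mul]
      at h4
    rw [eq_neg_iff_add_eq_zero, ← h4]
    abel
  have h5 := congrFun (congrFun h3 i) j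
  simp only [hD, hC, Matrix.of_apply, Matrix.neg_apply, Matrix.add_apply, Matrix.mul_apply,
    Matrix.transpose_apply, Fin.sum_univ_two] at h5
  rw [h5, Fin.sum_univ_two]
  ring

/-! ### Curvature -/

/-- The Ricci identity for one-forms. -/
theorem ricci_identity₁ (g : Metric S) {w : S → Fin 2 → Plane → ℝ} (hw : IsCovector w)
    (hy : y ∈ (extChartAt (𝓡 2) c).target) (i j k : Fin 2) :
    covD₂ g (covD₁ g w) c i j k y - covD₂ g (covD₁ g w) c j i k y
      = - ∑ l, riemann g c l k i j y * w c l y := by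
  have hG := differentiableAt_christoffel g hy
  have hW := hw.differentiableAt hy
  have hP : ∀ i j, DifferentiableAt ℝ (pderiv i (w c j)) y := fun i j =>
    differentiableAt_of_contDiffOn (isOpen_target c)
      (contDiffOn_pderiv (isOpen_target c) (hw.smooth c j)) hy
  have hD : ∀ i j k, pderiv i (covD₁ g w c j k) y = pderiv i (pderiv j (w c k)) y
      - ∑ l, (pderiv i (christoffel g c l j k) y * w c l y
        + christoffel g c l j k y * pderiv i (w c l) y) := by
    intro i j k
    change pderiv i (fun z => pderiv j (w c k) z - ∑ l, christoffel g c l j k z * w c l z) y = _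
    rw [pderiv_sub (hP j k) (DifferentiableAt.fun_sum fun l _ => (hG l j k).fun_mul (hW l)),
      pderiv_sum fun l _ => (hG l j k).fun_mul (hW l)]
    simp only [pderiv_mul (hG _ _ _) (hW _)]
  have hs := pderiv_comm (i := i) (j := j) (isOpen_target c) (hw.smooth c k) hy
  have hΓ : ∀ l, christoffel g c l j i y = christoffel g c l i j y :=
    fun l => christoffel_symm g c l j i y
  simp only [covD₂, hD, covD₁, riemann, Fin.sum_univ_two, hs, hΓ]
  ring

/-- The components `∇_i w_{jkl}` of the covariant derivative of a tensor field of rank three given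
by components. -/
def covD₃ (g : Metric S) (w : S → Fin 2 → Fin 2 → Fin 2 → Plane → ℝ) (c : S)
    (i j k l : Fin 2) (y : Plane) : ℝ :=
  pderiv i (w c j k l) y
    - ∑ m, (christoffel g c m i j y * w c m k l y + christoffel g c m i k y * w c j m l y
      + christoffel g c m i l y * w c j k m y)

/-- The Ricci identity for tensor fields of rank two. -/
theorem ricci_identity₂ (g : Metric S) {w : S → Fin 2 → Fin 2 → Plane → ℝ} (hw : IsTensor₂ w)
    (hy : y ∈ (extChartAt (𝓡 2) c).target) (i j k l : Fin 2) :
    covD₃ g (covD₂ g w) c i j k l y - covD₃ g (covD₂ g w) c j i k l y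
      = - ∑ m, (riemann g c m k i j y * w c m l y + riemann g c m l i j y * w c k m y) := by
  have hG := differentiableAt_christoffel g hy
  have hW := hw.differentiableAt hy
  have hP : ∀ i j k, DifferentiableAt ℝ (pderiv i (w c j k)) y := fun i j k =>
    differentiableAt_of_contDiffOn (isOpen_target c)
      (contDiffOn_pderiv (isOpen_target c) (hw.smooth c j k)) hy
  have hD : ∀ i j k l, pderiv i (covD₂ g w c j k l) y = pderiv i (pderiv j (w c k l)) y
      - ∑ m, ((pderiv i (christoffel g c m j k) y * w c m l y
        + christoffel g c m j k y * pderiv i (w c m l) y)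
        + (pderiv i (christoffel g c m j l) y * w c k m y
        + christoffel g c m j l y * pderiv i (w c k m) y)) := by
    intro i j k l
    have h1 := fun m => (hG m j k).fun_mul (hW m l)
    have h2 := fun m => (hG m j l).fun_mul (hW k m)
    change pderiv i (fun z => pderiv j (w c k l) z - ∑ m, (christoffel g c m j k z * w c m l z
      + christoffel g c m j l z * w c k m z)) y = _
    rw [pderiv_sub (hP j k l) (DifferentiableAt.fun_sum fun m _ => (h1 m).fun_add (h2 m)),
      pderiv_sum fun m _ => (h1 m).fun_add (h2 m)]
    refine congrArg₂ _ rfl (Finset.sum_congr rfl fun m _ => ?_)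
    rw [pderiv_add (h1 m) (h2 m), pderiv_mul (hG _ _ _) (hW _ _), pderiv_mul (hG _ _ _) (hW _ _)]
  have hs := pderiv_comm (i := i) (j := j) (isOpen_target c) (hw.smooth c k l) hy
  have hΓ : ∀ m, christoffel g c m j i y = christoffel g c m i j y :=
    fun m => christoffel_symm g c m j i y
  simp only [covD₃, hD, covD₂, riemann, Fin.sum_univ_two, hs, hΓ]
  ring

/-- The curvature tensor with all indices lowered, `R_{mkij} = ⟨R(∂_i, ∂_j) ∂_k, ∂_m⟩`. -/
def riemannLow (g : Metric S) (c : S) (m k i j : Fin 2) (y : Plane) : ℝ :=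
  ∑ l, gram g c y m l * riemann g c l k i j y

/-- The curvature endomorphism is skew-adjoint, as the metric is parallel. -/
theorem riemannLow_antisymm (g : Metric S) (hy : y ∈ (extChartAt (𝓡 2) c).target)
    (m k i j : Fin 2) : riemannLow g c m k i j y = - riemannLow g c k m i j y := by
  have hC := differentiableAt_christoffel g hy
  have hG := differentiableAt_gram g hy
  have hD : ∀ i j, pderiv i (pderiv j (fun z => gram g c z m k)) y
      = ∑ l, ((pderiv i (christoffel g c l j m) y * gram g c y l k
        + christoffel g c l j m y * pderiv i (fun z => gram g c z l k) y)
        + (pderiv i (christoffel g c l j k) y * gram g c y m l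
        + christoffel g c l j k y * pderiv i (fun z => gram g c z m l) y)) := by
    intro i j
    have h1 := fun l => (hC l j m).fun_mul (hG l k)
    have h2 := fun l => (hC l j k).fun_mul (hG m l)
    rw [pderiv_congr (f' := fun z => ∑ l, (christoffel g c l j m z * gram g c z l k
        + christoffel g c l j k z * gram g c z m l)) (by
      filter_upwards [(isOpen_target c).mem_nhds hy] with z hz
      exact pderiv_gram g hz j m k), pderiv_sum fun l _ => (h1 l).fun_add (h2 l)]
    refine Finset.sum_congr rfl fun l _ => ?_
    rw [pderiv_add (h1 l) (h2 l), pderiv_mul (hC _ _ _) (hG _ _), pderiv_mul (hC _ _ _) (hG _ _)]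
  have hs := pderiv_comm (i := i) (j := j) (isOpen_target c) (contDiffOn_gram g c m k) hy
  rw [hD, hD] at hs
  simp only [pderiv_gram g hy, Fin.sum_univ_two] at hs
  simp only [riemannLow, riemann, Fin.sum_univ_two]
  simp only [gram_symm g c y 1 0, gram_symm g c y k] at hs ⊢
  linear_combination hs

/-- The sectional curvature of the chart around `c`, which at the point `c` is the Gauss
curvature. -/
def chartCurvature (g : Metric S) (c : S) (y : Plane) : ℝ :=
  riemannLow g c 0 1 0 1 y / (gram g c y).det

theorem gramInv_det (g : Metric S) (hy : y ∈ (extChartAt (𝓡 2) c).target) :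
    (gram g c y).det * (gramInv g c y 0 0 * gramInv g c y 1 1 - gramInv g c y 0 1 ^ 2) = 1 := by
  have h := congrArg Matrix.det (gram_mul_gramInv g hy)
  rw [Matrix.det_mul, Matrix.det_fin_two (gramInv g c y), gramInv_symm g c y 1 0,
    Matrix.det_one] at h
  linear_combination h

theorem chartCurvature_eq (g : Metric S) (hy : y ∈ (extChartAt (𝓡 2) c).target) :
    chartCurvature g c y = riemannLow g c 0 1 0 1 y *
      (gramInv g c y 0 0 * gramInv g c y 1 1 - gramInv g c y 0 1 ^ 2) := by
  have h := gramInv_det g hy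
  have hd := (gram_det_pos g hy).ne'
  rw [chartCurvature, div_eq_iff hd]
  linear_combination (-riemannLow g c 0 1 0 1 y) * h

theorem riemann_eq_sum_low (g : Metric S) (hy : y ∈ (extChartAt (𝓡 2) c).target)
    (l k i j : Fin 2) :
    riemann g c l k i j y = ∑ m, gramInv g c y l m * riemannLow g c m k i j y := by
  have h : riemann g c l k i j y
      = ∑ m, (1 : Matrix (Fin 2) (Fin 2) ℝ) l m * riemann g c m k i j y := by
    simp [Matrix.one_apply]
  rw [h]
  simp only [riemannLow, ← sum_gramInv_mul_gram g hy, Fin.sum_univ_two]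
  ring

/-- In dimension two the curvature tensor has one independent component. -/
theorem riemann_zero (g : Metric S) (hy : y ∈ (extChartAt (𝓡 2) c).target) (l : Fin 2) :
    riemann g c l 0 0 1 y = -(gramInv g c y l 1 * riemannLow g c 0 1 0 1 y) := by
  have h0 := riemannLow_antisymm g hy 0 0 0 1
  rw [riemann_eq_sum_low g hy, Fin.sum_univ_two, riemannLow_antisymm g hy 1 0 0 1]
  linear_combination (1 / 2) * gramInv g c y l 0 * h0

theorem riemann_one (g : Metric S) (hy : y ∈ (extChartAt (𝓡 2) c).target) (l : Fin 2) :
    riemann g c l 1 0 1 y = gramInv g c y l 0 * riemannLow g c 0 1 0 1 y := by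
  have h1 := riemannLow_antisymm g hy 1 1 0 1
  rw [riemann_eq_sum_low g hy, Fin.sum_univ_two]
  linear_combination (1 / 2) * gramInv g c y l 1 * h1

end Compatibility

/-! ### Contractions -/

section Contractions

variable {S : Type*} [TopologicalSpace S] [ChartedSpace Plane S] [IsManifold (𝓡 2) ∞ S]

/-- The trace `g^{ab} w_{ab}`. -/
def trace₂ (g : Metric S) (w : S → Fin 2 → Fin 2 → Plane → ℝ) (c : S) (y : Plane) : ℝ :=
  ∑ a, ∑ b, gramInv g c y a b * w c a b y

/-- The trace `g^{ab} w_{abj}` in the first two indices. -/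
def trace₃ (g : Metric S) (w : S → Fin 2 → Fin 2 → Fin 2 → Plane → ℝ) (c : S) (j : Fin 2)
    (y : Plane) : ℝ :=
  ∑ a, ∑ b, gramInv g c y a b * w c a b j y

/-- The squared length of a one-form. -/
def lengthSq₁ (g : Metric S) (w : S → Fin 2 → Plane → ℝ) (c : S) (y : Plane) : ℝ :=
  ∑ a, ∑ b, gramInv g c y a b * w c a y * w c b y

/-- The squared length of a tensor field of rank two. -/
def lengthSq₂ (g : Metric S) (w : S → Fin 2 → Fin 2 → Plane → ℝ) (c : S) (y : Plane) : ℝ :=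
  ∑ a, ∑ b, ∑ e, ∑ f, gramInv g c y a e * gramInv g c y b f * w c a b y * w c e f y

/-- The squared length of a tensor field of rank three. -/
def lengthSq₃ (g : Metric S) (w : S → Fin 2 → Fin 2 → Fin 2 → Plane → ℝ) (c : S)
    (y : Plane) : ℝ :=
  ∑ a, ∑ b, ∑ e, ∑ a', ∑ b', ∑ e', gramInv g c y a a' * gramInv g c y b b' * gramInv g c y e e' *
    w c a b e y * w c a' b' e' y

/-- The divergence `∇^a w_a` of a one-form given by components. -/
def divergence (g : Metric S) (w : S → Fin 2 → Plane → ℝ) : S → Plane → ℝ :=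
  trace₂ g (covD₁ g w)

theorem IsTensor₂.trace₂ (g : Metric S) {w : S → Fin 2 → Fin 2 → Plane → ℝ} (hw : IsTensor₂ w) :
    IsScalar (trace₂ g w) where
  smooth c := ContDiffOn.sum fun a _ => ContDiffOn.sum fun b _ =>
    (contDiffOn_gramInv g c a b).mul (hw.smooth c a b)
  transform c d y hy := by
    simp only [Surface.trace₂, hw.transform c d y hy, gramInv_transform g hy, Fin.sum_univ_two]
    ring

theorem IsTensor₃.trace₃ (g : Metric S) {w : S → Fin 2 → Fin 2 → Fin 2 → Plane → ℝ}
    (hw : IsTensor₃ w) : IsCovector (trace₃ g w) where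
  smooth c j := ContDiffOn.sum fun a _ => ContDiffOn.sum fun b _ =>
    (contDiffOn_gramInv g c a b).mul (hw.smooth c a b j)
  transform c d y hy j := by
    simp only [Surface.trace₃, hw.transform c d y hy, gramInv_transform g hy, Fin.sum_univ_two]
    ring

theorem IsCovector.lengthSq₁ (g : Metric S) {w : S → Fin 2 → Plane → ℝ} (hw : IsCovector w) :
    IsScalar (lengthSq₁ g w) where
  smooth c := ContDiffOn.sum fun a _ => ContDiffOn.sum fun b _ =>
    ((contDiffOn_gramInv g c a b).mul (hw.smooth c a)).mul (hw.smooth c b)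
  transform c d y hy := by
    simp only [Surface.lengthSq₁, hw.transform c d y hy, gramInv_transform g hy, Fin.sum_univ_two]
    ring

theorem IsTensor₂.lengthSq₂ (g : Metric S) {w : S → Fin 2 → Fin 2 → Plane → ℝ}
    (hw : IsTensor₂ w) : IsScalar (lengthSq₂ g w) where
  smooth c := ContDiffOn.sum fun a _ => ContDiffOn.sum fun b _ => ContDiffOn.sum fun e _ =>
    ContDiffOn.sum fun f _ => (((contDiffOn_gramInv g c a e).mul (contDiffOn_gramInv g c b f)).mul
      (hw.smooth c a b)).mul (hw.smooth c e f)
  transform c d y hy := by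
    simp only [Surface.lengthSq₂, hw.transform c d y hy, gramInv_transform g hy, Fin.sum_univ_two]
    ring

/-- The one-form `β^a ∇_a β_j - β_j ∇^a β_a` of the Bochner formula for one-forms. -/
def flux₁ (g : Metric S) (w : S → Fin 2 → Plane → ℝ) (c : S) (j : Fin 2) (y : Plane) : ℝ :=
  ∑ a, ∑ b, gramInv g c y a b * (w c a y * covD₁ g w c b j y - w c j y * covD₁ g w c a b y)

/-- The one-form `Z^{bd} ∇_b Z_{jd} - Z_j{}^b ∇^d Z_{db}` of the Bochner formula for symmetric
trace-free tensor fields. -/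
def flux₂ (g : Metric S) (w : S → Fin 2 → Fin 2 → Plane → ℝ) (c : S) (j : Fin 2)
    (y : Plane) : ℝ :=
  ∑ a, ∑ b, ∑ e, ∑ f, gramInv g c y a b * gramInv g c y e f *
    (w c a e y * covD₂ g w c b j f y - w c j a y * covD₂ g w c e f b y)

theorem IsCovector.flux₁ (g : Metric S) {w : S → Fin 2 → Plane → ℝ} (hw : IsCovector w) :
    IsCovector (flux₁ g w) where
  smooth c j := ContDiffOn.sum fun a _ => ContDiffOn.sum fun b _ =>
    (contDiffOn_gramInv g c a b).mul (((hw.smooth c a).mul ((hw.covD₁ g).smooth c b j)).sub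
      ((hw.smooth c j).mul ((hw.covD₁ g).smooth c a b)))
  transform c d y hy j := by
    simp only [Surface.flux₁, hw.transform c d y hy, (hw.covD₁ g).transform c d y hy,
      gramInv_transform g hy, Fin.sum_univ_two]
    ring

theorem IsTensor₂.flux₂ (g : Metric S) {w : S → Fin 2 → Fin 2 → Plane → ℝ} (hw : IsTensor₂ w) :
    IsCovector (flux₂ g w) where
  smooth c j := ContDiffOn.sum fun a _ => ContDiffOn.sum fun b _ => ContDiffOn.sum fun e _ =>
    ContDiffOn.sum fun f _ => ((contDiffOn_gramInv g c a b).mul (contDiffOn_gramInv g c e f)).mul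
      (((hw.smooth c a e).mul ((hw.covD₂ g).smooth c b j f)).sub
        ((hw.smooth c j a).mul ((hw.covD₂ g).smooth c e f b)))
  transform c d y hy j := by
    simp only [Surface.flux₂, hw.transform c d y hy, (hw.covD₂ g).transform c d y hy,
      gramInv_transform g hy, Fin.sum_univ_two, gramInv_symm g c y 1 0]
    ring

end Contractions

/-! ### Pointwise Bochner formulas -/

section Bochner

variable {S : Type*} [TopologicalSpace S] [ChartedSpace Plane S] [IsManifold (𝓡 2) ∞ S]
variable {c : S} {y : Plane}

/-- The Leibniz rule for the covariant derivative of `flux₁`. -/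
theorem covD₁_flux₁ (g : Metric S) {w : S → Fin 2 → Plane → ℝ} (hw : IsCovector w)
    (hy : y ∈ (extChartAt (𝓡 2) c).target) (i j : Fin 2) :
    covD₁ g (flux₁ g w) c i j y = ∑ a, ∑ b, gramInv g c y a b *
      (covD₁ g w c i a y * covD₁ g w c b j y + w c a y * covD₂ g (covD₁ g w) c i b j y
        - covD₁ g w c i j y * covD₁ g w c a b y - w c j y * covD₂ g (covD₁ g w) c i a b y) := by
  have hT := hw.covD₁ g
  have hh := differentiableAt_gramInv g hy
  have hW := hw.differentiableAt hy
  have hD := hT.differentiableAt hy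
  have h1 := fun a b => (hW a).fun_mul (hD b j)
  have h2 := fun a b => (hW j).fun_mul (hD a b)
  have h3 := fun a b => (h1 a b).fun_sub (h2 a b)
  have h4 := fun a b => (hh a b).fun_mul (h3 a b)
  have hp : pderiv i (flux₁ g w c j) y = ∑ a, ∑ b,
      (pderiv i (fun z => gramInv g c z a b) y
          * (w c a y * covD₁ g w c b j y - w c j y * covD₁ g w c a b y)
        + gramInv g c y a b * (pderiv i (w c a) y * covD₁ g w c b j y
          + w c a y * pderiv i (covD₁ g w c b j) y - (pderiv i (w c j) y * covD₁ g w c a b y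
          + w c j y * pderiv i (covD₁ g w c a b) y))) := by
    change pderiv i (fun z => ∑ a, ∑ b, gramInv g c z a b *
      (w c a z * covD₁ g w c b j z - w c j z * covD₁ g w c a b z)) y = _
    rw [pderiv_sum fun a _ => DifferentiableAt.fun_sum fun b _ => h4 a b]
    refine Finset.sum_congr rfl fun a _ => ?_
    rw [pderiv_sum fun b _ => h4 a b]
    refine Finset.sum_congr rfl fun b _ => ?_
    rw [pderiv_mul (hh a b) (h3 a b), pderiv_sub (h1 a b) (h2 a b), pderiv_mul (hW a) (hD b j),
      pderiv_mul (hW j) (hD a b)]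
  -- partial derivatives in terms of covariant derivatives; the Christoffel symbols then cancel
  have e1 : ∀ a, pderiv i (w c a) y
      = covD₁ g w c i a y + ∑ k, christoffel g c k i a y * w c k y := fun a => by
    rw [covD₁]; ring
  have e2 : ∀ a b, pderiv i (covD₁ g w c a b) y = covD₂ g (covD₁ g w) c i a b y
      + ∑ l, (christoffel g c l i a y * covD₁ g w c l b y
        + christoffel g c l i b y * covD₁ g w c a l y) := fun a b => by
    rw [covD₂]; ring
  rw [covD₁, hp]
  simp only [e1, e2, pderiv_gramInv g hy, flux₁]
  generalize covD₁ g w = T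
  generalize covD₂ g T = N
  simp only [Fin.sum_univ_two]
  ring

/-- The Leibniz rule for the covariant derivative of `flux₂`. -/
theorem covD₁_flux₂ (g : Metric S) {w : S → Fin 2 → Fin 2 → Plane → ℝ} (hw : IsTensor₂ w)
    (hy : y ∈ (extChartAt (𝓡 2) c).target) (i j : Fin 2) :
    covD₁ g (flux₂ g w) c i j y = ∑ a, ∑ b, ∑ e, ∑ f, gramInv g c y a b * gramInv g c y e f *
      (covD₂ g w c i a e y * covD₂ g w c b j f y + w c a e y * covD₃ g (covD₂ g w) c i b j f y
        - covD₂ g w c i j a y * covD₂ g w c e f b y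
        - w c j a y * covD₃ g (covD₂ g w) c i e f b y) := by
  have hT := hw.covD₂ g
  have hh := differentiableAt_gramInv g hy
  have hW := hw.differentiableAt hy
  have hD : ∀ a b e, DifferentiableAt ℝ (covD₂ g w c a b e) y := fun a b e =>
    differentiableAt_of_contDiffOn (isOpen_target c) (hT.smooth c a b e) hy
  have h1 := fun a b e f => (hW a e).fun_mul (hD b j f)
  have h2 := fun a b e f => (hW j a).fun_mul (hD e f b)
  have h3 := fun a b e f => (h1 a b e f).fun_sub (h2 a b e f)
  have h5 := fun a b e f => (hh a b).fun_mul (hh e f)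
  have h4 := fun a b e f => (h5 a b e f).fun_mul (h3 a b e f)
  have hp : pderiv i (flux₂ g w c j) y = ∑ a, ∑ b, ∑ e, ∑ f,
      ((pderiv i (fun z => gramInv g c z a b) y * gramInv g c y e f
          + gramInv g c y a b * pderiv i (fun z => gramInv g c z e f) y)
          * (w c a e y * covD₂ g w c b j f y - w c j a y * covD₂ g w c e f b y)
        + gramInv g c y a b * gramInv g c y e f * (pderiv i (w c a e) y * covD₂ g w c b j f y
          + w c a e y * pderiv i (covD₂ g w c b j f) y - (pderiv i (w c j a) y * covD₂ g w c e f b y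
          + w c j a y * pderiv i (covD₂ g w c e f b) y))) := by
    change pderiv i (fun z => ∑ a, ∑ b, ∑ e, ∑ f, gramInv g c z a b * gramInv g c z e f *
      (w c a e z * covD₂ g w c b j f z - w c j a z * covD₂ g w c e f b z)) y = _
    rw [pderiv_sum fun a _ => DifferentiableAt.fun_sum fun b _ => DifferentiableAt.fun_sum fun e _ =>
      DifferentiableAt.fun_sum fun f _ => h4 a b e f]
    refine Finset.sum_congr rfl fun a _ => ?_
    rw [pderiv_sum fun b _ => DifferentiableAt.fun_sum fun e _ =>
      DifferentiableAt.fun_sum fun f _ => h4 a b e f]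
    refine Finset.sum_congr rfl fun b _ => ?_
    rw [pderiv_sum fun e _ => DifferentiableAt.fun_sum fun f _ => h4 a b e f]
    refine Finset.sum_congr rfl fun e _ => ?_
    rw [pderiv_sum fun f _ => h4 a b e f]
    refine Finset.sum_congr rfl fun f _ => ?_
    rw [pderiv_mul (h5 a b e f) (h3 a b e f), pderiv_mul (hh a b) (hh e f),
      pderiv_sub (h1 a b e f) (h2 a b e f), pderiv_mul (hW a e) (hD b j f),
      pderiv_mul (hW j a) (hD e f b)]
  -- partial derivatives in terms of covariant derivatives; the Christoffel symbols then cancel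
  have e1 : ∀ a b, pderiv i (w c a b) y = covD₂ g w c i a b y
      + ∑ l, (christoffel g c l i a y * w c l b y + christoffel g c l i b y * w c a l y) :=
    fun a b => by rw [covD₂]; ring
  have e2 : ∀ a b e, pderiv i (covD₂ g w c a b e) y = covD₃ g (covD₂ g w) c i a b e y
      + ∑ m, (christoffel g c m i a y * covD₂ g w c m b e y
        + christoffel g c m i b y * covD₂ g w c a m e y
        + christoffel g c m i e y * covD₂ g w c a b m y) := fun a b e => by
    rw [covD₃]; ring
  rw [covD₁, hp]
  simp only [e1, e2, pderiv_gramInv g hy, flux₂]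
  generalize covD₂ g w = T
  generalize covD₃ g T = N
  simp only [Fin.sum_univ_two, gramInv_symm g c y 1 0]
  ring

/-- The pointwise Bochner formula for one-forms. -/
theorem bochner₁ (g : Metric S) {w : S → Fin 2 → Plane → ℝ} (hw : IsCovector w)
    (hy : y ∈ (extChartAt (𝓡 2) c).target) :
    lengthSq₂ g (covD₁ g w) c y + chartCurvature g c y * lengthSq₁ g w c y
      = (1 / 2) * lengthSq₂ g (fun c i j y => covD₁ g w c i j y - covD₁ g w c j i y) c y
        + divergence g w c y ^ 2 + divergence g (flux₁ g w) c y := by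
  have hR : ∀ k, covD₂ g (covD₁ g w) c 1 0 k y = covD₂ g (covD₁ g w) c 0 1 k y
      + ∑ l, riemann g c l k 0 1 y * w c l y := fun k => by
    linear_combination -(ricci_identity₁ g hw hy 0 1 k)
  have h0 := hR 0
  have h1 := hR 1
  simp only [riemann_zero g hy, riemann_one g hy] at h0 h1
  simp only [divergence, trace₂, covD₁_flux₁ g hw hy, lengthSq₁, lengthSq₂,
    chartCurvature_eq g hy]
  generalize covD₁ g w = T at *
  generalize covD₂ g T = N at *
  simp only [Fin.sum_univ_two, gramInv_symm g c y 1 0] at h0 h1 ⊢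
  rw [h0, h1]
  ring

/-- The trace commutes with the covariant derivative. -/
theorem sum_gramInv_covD₂ (g : Metric S) {w : S → Fin 2 → Fin 2 → Plane → ℝ} (hw : IsTensor₂ w)
    (hy : y ∈ (extChartAt (𝓡 2) c).target) (i : Fin 2) :
    ∑ a, ∑ b, gramInv g c y a b * covD₂ g w c i a b y = pderiv i (trace₂ g w c) y := by
  have hh := differentiableAt_gramInv g hy
  have hW := hw.differentiableAt hy
  have h1 := fun a b => (hh a b).fun_mul (hW a b)
  have hp : pderiv i (trace₂ g w c) y = ∑ a, ∑ b, (pderiv i (fun z => gramInv g c z a b) y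
      * w c a b y + gramInv g c y a b * pderiv i (w c a b) y) := by
    change pderiv i (fun z => ∑ a, ∑ b, gramInv g c z a b * w c a b z) y = _
    rw [pderiv_sum fun a _ => DifferentiableAt.fun_sum fun b _ => h1 a b]
    refine Finset.sum_congr rfl fun a _ => ?_
    rw [pderiv_sum fun b _ => h1 a b]
    exact Finset.sum_congr rfl fun b _ => pderiv_mul (hh a b) (hW a b)
  rw [hp]
  simp only [pderiv_gramInv g hy, covD₂, Fin.sum_univ_two]
  ring

/-- The pointwise Bochner formula for symmetric trace-free tensor fields. -/
theorem bochner₂ (g : Metric S) {w : S → Fin 2 → Fin 2 → Plane → ℝ} (hw : IsTensor₂ w)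
    (hsymm : ∀ c i j, w c i j = w c j i)
    (htr : ∀ c, ∀ z ∈ (extChartAt (𝓡 2) c).target, trace₂ g w c z = 0)
    (hy : y ∈ (extChartAt (𝓡 2) c).target) :
    lengthSq₃ g (covD₂ g w) c y + 2 * chartCurvature g c y * lengthSq₂ g w c y
      = 2 * lengthSq₁ g (trace₃ g (covD₂ g w)) c y + divergence g (flux₂ g w) c y := by
  have hR : ∀ k l, covD₃ g (covD₂ g w) c 1 0 k l y = covD₃ g (covD₂ g w) c 0 1 k l y
      + ∑ m, (riemann g c m k 0 1 y * w c m l y + riemann g c m l 0 1 y * w c k m y) :=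
    fun k l => by linear_combination -(ricci_identity₂ g hw hy 0 1 k l)
  have hts : ∀ i, covD₂ g w c i 1 0 = covD₂ g w c i 0 1 := fun i => by
    funext z
    simp only [covD₂, hsymm c 1 0, Fin.sum_univ_two]
    ring
  have hns : ∀ i j, covD₃ g (covD₂ g w) c i j 1 0 y = covD₃ g (covD₂ g w) c i j 0 1 y := by
    intro i j
    simp only [covD₃, hts, Fin.sum_univ_two]
    ring
  have ht : ∀ i, ∑ a, ∑ b, gramInv g c y a b * covD₂ g w c i a b y = 0 := fun i => by
    rw [sum_gramInv_covD₂ g hw hy, pderiv_congr (f' := fun _ => 0), pderiv_const]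
    filter_upwards [(isOpen_target c).mem_nhds hy] with z hz
    exact htr c z hz
  have hz := htr c y hy
  have t0 := ht 0
  have t1 := ht 1
  have h00 := hR 0 0
  have h01 := hR 0 1
  have h11 := hR 1 1
  simp only [trace₂, riemann_zero g hy, riemann_one g hy, Fin.sum_univ_two, gramInv_symm g c y 1 0,
    hsymm c 1 0] at h00 h01 h11 hz
  simp only [Fin.sum_univ_two, gramInv_symm g c y 1 0, hts] at t0 t1
  simp only [divergence, trace₂, covD₁_flux₂ g hw hy, lengthSq₁, lengthSq₂, lengthSq₃, trace₃,
    chartCurvature_eq g hy]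
  generalize covD₃ g (covD₂ g w) = N at *
  generalize covD₂ g w = T at *
  simp only [Fin.sum_univ_two, gramInv_symm g c y 1 0, hts, hns, h00, h01, h11, hsymm c 1 0]
  generalize gramInv g c y 0 0 = p at *
  generalize gramInv g c y 0 1 = q at *
  generalize gramInv g c y 1 1 = r at *
  generalize riemannLow g c 0 1 0 1 y = κ at *
  -- With `D_a` the divergence and `t_a = g^{bc} ∇_a Z_{bc}`, the first-order terms differ by
  -- `|∇Z|² - ∇_a Z_{bc} ∇^b Z^{ac} = g^{ab} (D_a - t_a) (D_b - t_b)` from the claim, and the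
  -- curvature terms by `k̂ (tr Z)²`; this gives the coefficients of `t0`, `t1` and `hz`.
  linear_combination
    (p * (-2 * (p * T c 0 0 0 y + q * T c 0 0 1 y + q * T c 1 0 0 y + r * T c 1 0 1 y)
        + (p * T c 0 0 0 y + 2 * q * T c 0 0 1 y + r * T c 0 1 1 y))
      + q * (-2 * (p * T c 0 0 1 y + q * T c 0 1 1 y + q * T c 1 0 1 y + r * T c 1 1 1 y)
        + (p * T c 1 0 0 y + 2 * q * T c 1 0 1 y + r * T c 1 1 1 y))) * t0
    + (q * (-2 * (p * T c 0 0 0 y + q * T c 0 0 1 y + q * T c 1 0 0 y + r * T c 1 0 1 y)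
        + (p * T c 0 0 0 y + 2 * q * T c 0 0 1 y + r * T c 0 1 1 y))
      + r * (-2 * (p * T c 0 0 1 y + q * T c 0 1 1 y + q * T c 1 0 1 y + r * T c 1 1 1 y)
        + (p * T c 1 0 0 y + 2 * q * T c 1 0 1 y + r * T c 1 1 1 y))) * t1
    + (p * r - q ^ 2) * κ * (p * w c 0 0 y + 2 * q * w c 0 1 y + r * w c 1 1 y) * hz

end Bochner

/-! ### The area measure -/

section Area

variable {S : Type*} [TopologicalSpace S] [ChartedSpace Plane S] [IsManifold (𝓡 2) ∞ S]

/-- The area density `√(det g_{ij})` of a chart. -/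
def density (g : Metric S) (c : S) (y : Plane) : ℝ := Real.sqrt (gram g c y).det

theorem density_pos (g : Metric S) {c : S} {y : Plane} (hy : y ∈ (extChartAt (𝓡 2) c).target) :
    0 < density g c y := Real.sqrt_pos.2 (gram_det_pos g hy)

theorem contDiffOn_density (g : Metric S) (c : S) :
    ContDiffOn ℝ ∞ (density g c) (extChartAt (𝓡 2) c).target :=
  (contDiffOn_gram_det g c).sqrt fun _ hy => (gram_det_pos g hy).ne'

theorem density_transform (g : Metric S) {c d : S} {y : Plane} (hy : y ∈ overlap c d) :
    density g c y = |(jacMatrix c d y).det| * density g d (trans c d y) := by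
  rw [density, density, gram_det_transform g hy, Real.sqrt_mul (sq_nonneg _), Real.sqrt_sq_eq_abs]

theorem det_fderiv_trans {c d : S} {y : Plane} (hy : y ∈ overlap c d) :
    (fderiv ℝ (trans c d) y).det = (jacMatrix c d y).det := by
  rw [ContinuousLinearMap.det,
    ← LinearMap.det_toMatrix (EuclideanSpace.basisFun (Fin 2) ℝ).toBasis]
  congr 1
  ext a i
  rw [LinearMap.toMatrix_apply]
  simp only [OrthonormalBasis.coe_toBasis, EuclideanSpace.basisFun_apply,
    ContinuousLinearMap.coe_coe, fderiv_trans_single hy]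
  fin_cases a <;> simp [jacMatrix, Fin.sum_univ_two]

variable [MeasurableSpace S]

/-- The measure `√(det g_{ij}) dy` of a chart, pushed forward to the surface. -/
def chartMeasure (g : Metric S) (c : S) : Measure S :=
  Measure.map (extChartAt (𝓡 2) c).symm
    ((volume.restrict (extChartAt (𝓡 2) c).target).withDensity
      fun y => ENNReal.ofReal (density g c y))

omit [IsManifold (𝓡 2) ∞ S] [MeasurableSpace S] in
theorem measurableSet_target (c : S) : MeasurableSet (extChartAt (𝓡 2) c).target :=
  (isOpen_target c).measurableSet

omit [MeasurableSpace S] in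
theorem aemeasurable_density (g : Metric S) (c : S) :
    AEMeasurable (density g c) (volume.restrict (extChartAt (𝓡 2) c).target) :=
  (contDiffOn_density g c).continuousOn.aemeasurable (measurableSet_target c)

variable [BorelSpace S]

omit [IsManifold (𝓡 2) ∞ S] in
theorem aemeasurable_symm (c : S) :
    AEMeasurable (extChartAt (𝓡 2) c).symm (volume.restrict (extChartAt (𝓡 2) c).target) :=
  (continuousOn_extChartAt_symm c).aemeasurable (measurableSet_target c)

theorem aemeasurable_symm_withDensity (g : Metric S) (c : S) :
    AEMeasurable (extChartAt (𝓡 2) c).symm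
      ((volume.restrict (extChartAt (𝓡 2) c).target).withDensity
        fun y => ENNReal.ofReal (density g c y)) :=
  (aemeasurable_symm c).mono_ac (withDensity_absolutelyContinuous _ _)

theorem chartMeasure_apply (g : Metric S) (c : S) {A : Set S} (hA : MeasurableSet A) :
    chartMeasure g c A = ∫⁻ y in (extChartAt (𝓡 2) c).symm ⁻¹' A ∩ (extChartAt (𝓡 2) c).target,
      ENNReal.ofReal (density g c y) := by
  rw [chartMeasure, Measure.map_apply_of_aemeasurable (aemeasurable_symm_withDensity g c) hA,
    withDensity_apply', Measure.restrict_restrict' (measurableSet_target c)]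

omit [IsManifold (𝓡 2) ∞ S] in
theorem measurableSet_preimage_inter_target (c : S) {A : Set S} (hA : MeasurableSet A) :
    MeasurableSet ((extChartAt (𝓡 2) c).symm ⁻¹' A ∩ (extChartAt (𝓡 2) c).target) := by
  have h1 : Measurable ((extChartAt (𝓡 2) c).target.domRestrict (extChartAt (𝓡 2) c).symm) :=
    (continuousOn_iff_continuous_domRestrict.1 (continuousOn_extChartAt_symm c)).measurable
  have h2 := (measurableSet_target c).subtype_image (h1 hA)
  convert h2 using 1
  ext y
  exact ⟨fun h => ⟨⟨y, h.2⟩, h.1, rfl⟩, by rintro ⟨z, hz, rfl⟩; exact ⟨hz, z.2⟩⟩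

/-- The chart measures agree on overlaps, by the change of variables formula. -/
theorem chartMeasure_eq_of_subset (g : Metric S) (c d : S) {A : Set S} (hA : MeasurableSet A)
    (hc : A ⊆ (extChartAt (𝓡 2) c).source) (hd : A ⊆ (extChartAt (𝓡 2) d).source) :
    chartMeasure g d A = chartMeasure g c A := by
  rw [chartMeasure_apply g c hA, chartMeasure_apply g d hA]
  set B := (extChartAt (𝓡 2) c).symm ⁻¹' A ∩ (extChartAt (𝓡 2) c).target with hB
  have hover : ∀ y ∈ B, y ∈ overlap c d := fun y hy => ⟨hy.2, hd hy.1⟩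
  have himage : (extChartAt (𝓡 2) d).symm ⁻¹' A ∩ (extChartAt (𝓡 2) d).target
      = trans c d '' B := by
    ext z
    constructor
    · rintro ⟨h1, h2⟩
      have hz : z ∈ overlap d c := ⟨h2, hc h1⟩
      exact ⟨trans d c z, ⟨by rw [Set.mem_preimage, symm_trans hz]; exact h1,
        trans_mem_target hz⟩, trans_trans hz⟩
    · rintro ⟨y, hy, rfl⟩
      exact ⟨by rw [Set.mem_preimage, symm_trans (hover y hy)]; exact hy.1,
        trans_mem_target (hover y hy)⟩
  rw [himage, lintegral_image_eq_lintegral_abs_det_fderiv_mul volume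
    (measurableSet_preimage_inter_target c hA) (f' := fderiv ℝ (trans c d))
    (fun y hy => (differentiableAt_trans (hover y hy)).hasFDerivAt.hasFDerivWithinAt)
    (fun y hy z hz h => by rw [← trans_trans (hover y hy), h, trans_trans (hover z hz)])]
  refine setLIntegral_congr_fun (measurableSet_preimage_inter_target c hA) fun y hy => ?_
  rw [← ENNReal.ofReal_mul (abs_nonneg _), det_fderiv_trans (hover y hy),
    ← density_transform g (hover y hy)]

omit [IsManifold (𝓡 2) ∞ S] in
theorem measurableSet_source (c : S) : MeasurableSet (extChartAt (𝓡 2) c).source :=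
  (isOpen_extChartAt_source c).measurableSet

theorem chartMeasure_inter_source (g : Metric S) (c : S) {A : Set S} (hA : MeasurableSet A) :
    chartMeasure g c (A ∩ (extChartAt (𝓡 2) c).source) = chartMeasure g c A := by
  rw [chartMeasure_apply g c hA, chartMeasure_apply g c (hA.inter (measurableSet_source c))]
  congr 2
  ext y
  simp only [Set.mem_inter_iff, Set.mem_preimage]
  exact ⟨fun h => ⟨h.1.1, h.2⟩, fun h => ⟨⟨h.1, (extChartAt (𝓡 2) c).map_target h.2⟩, h.2⟩⟩

/-- On the domain of a chart the area measure is the measure of the chart. -/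
theorem area_apply_of_subset (g : Metric S) (c : S) {A : Set S} (hA : MeasurableSet A)
    (hc : A ⊆ (extChartAt (𝓡 2) c).source) : area g A = chartMeasure g c A := by
  classical
  refine le_antisymm ?_ (le_iSup (chartMeasure g) c A)
  -- an upper bound of all chart measures that is infinite outside the chart around `c`
  set ν : Measure S := chartMeasure g c
    + ((⊤ : ENNReal) • Measure.count).restrict (extChartAt (𝓡 2) c).sourceᶜ with hν
  have hle : area g ≤ ν := by
    refine iSup_le fun d => Measure.le_iff.2 fun B hB => ?_
    change chartMeasure g d B ≤ ν B
    by_cases hBc : B ⊆ (extChartAt (𝓡 2) c).source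
    · rw [← chartMeasure_inter_source g d hB, chartMeasure_eq_of_subset g c d
        (hB.inter (measurableSet_source d)) (Set.inter_subset_left.trans hBc)
        Set.inter_subset_right, hν, Measure.add_apply]
      exact (measure_mono Set.inter_subset_left).trans le_self_add
    · have hne : (B ∩ (extChartAt (𝓡 2) c).sourceᶜ).Nonempty := by
        obtain ⟨x, hx, hx'⟩ := Set.not_subset.1 hBc
        exact ⟨x, hx, hx'⟩
      have : ν B = ⊤ := by
        rw [hν, Measure.add_apply, Measure.restrict_apply hB, Measure.smul_apply, smul_eq_mul,
          ENNReal.top_mul (Measure.count_ne_zero hne), add_top]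
      rw [this]
      exact le_top
  refine (hle A).trans ?_
  have : A ∩ (extChartAt (𝓡 2) c).sourceᶜ = ∅ := by
    rw [← Set.sdiff_eq, Set.sdiff_eq_empty.2 hc]
  rw [hν, Measure.add_apply, Measure.restrict_apply hA, this, measure_empty, add_zero]

theorem area_restrict_source (g : Metric S) (c : S) :
    (area g).restrict (extChartAt (𝓡 2) c).source = chartMeasure g c := by
  ext A hA
  rw [Measure.restrict_apply hA, area_apply_of_subset g c (hA.inter (measurableSet_source c))
    Set.inter_subset_right, chartMeasure_inter_source g c hA]

/-- The integral over the domain of a chart in coordinates. -/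
theorem setIntegral_area_source (g : Metric S) (c : S) {f : S → ℝ} (hf : Continuous f) :
    ∫ p in (extChartAt (𝓡 2) c).source, f p ∂(area g)
      = ∫ y in (extChartAt (𝓡 2) c).target,
        density g c y * f ((extChartAt (𝓡 2) c).symm y) := by
  rw [area_restrict_source, chartMeasure, integral_map (aemeasurable_symm_withDensity g c)
    hf.measurable.aestronglyMeasurable, integral_withDensity_eq_integral_toReal_smul₀
    (aemeasurable_density g c).ennreal_ofReal (by simp)]
  refine integral_congr_ae (Filter.Eventually.of_forall fun y => ?_)
  simp only [density, smul_eq_mul]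
  rw [ENNReal.toReal_ofReal (Real.sqrt_nonneg _)]

instance isLocallyFiniteMeasure_area (g : Metric S) : IsLocallyFiniteMeasure (area g) where
  finiteAtNhds p := by
    have hp : extChartAt (𝓡 2) p p ∈ (extChartAt (𝓡 2) p).target := mem_extChartAt_target p
    obtain ⟨r, hr, hball⟩ := Metric.nhds_basis_closedBall.mem_iff.1
      ((isOpen_target p).mem_nhds hp)
    set W : Set S := (extChartAt (𝓡 2) p).source ∩
      extChartAt (𝓡 2) p ⁻¹' Metric.ball (extChartAt (𝓡 2) p p) r with hW
    have hWo : IsOpen W := (continuousOn_extChartAt p).isOpen_inter_preimage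
      (isOpen_extChartAt_source p) Metric.isOpen_ball
    refine ⟨W, hWo.mem_nhds ⟨mem_extChartAt_source p, Metric.mem_ball_self hr⟩, ?_⟩
    rw [area_apply_of_subset g p hWo.measurableSet Set.inter_subset_left,
      chartMeasure_apply g p hWo.measurableSet]
    have hint : IntegrableOn (density g p) (Metric.closedBall (extChartAt (𝓡 2) p p) r) :=
      ((contDiffOn_density g p).continuousOn.mono hball).integrableOn_compact
        (isCompact_closedBall _ _)
    refine (lintegral_mono_set ?_).trans_lt (Integrable.lintegral_lt_top hint)
    rintro y ⟨h1, h2⟩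
    have := h1.2
    rw [Set.mem_preimage, (extChartAt (𝓡 2) p).right_inv h2] at this
    exact Metric.ball_subset_closedBall this

instance isOpenPosMeasure_area (g : Metric S) : (area g).IsOpenPosMeasure where
  open_pos U hU hne := by
    obtain ⟨p, hp⟩ := hne
    set V : Set S := U ∩ (extChartAt (𝓡 2) p).source with hV
    have hVo : IsOpen V := hU.inter (isOpen_extChartAt_source p)
    intro h0
    have h1 : area g V = 0 := measure_mono_null Set.inter_subset_left h0
    set B := (extChartAt (𝓡 2) p).symm ⁻¹' V ∩ (extChartAt (𝓡 2) p).target with hB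
    have hBo : IsOpen B := by
      rw [hB, Set.inter_comm]
      exact (continuousOn_extChartAt_symm p).isOpen_inter_preimage (isOpen_target p) hVo
    have hBne : B.Nonempty := ⟨extChartAt (𝓡 2) p p, by
      rw [Set.mem_preimage, extChartAt_to_inv]
      exact ⟨hp, mem_extChartAt_source p⟩, mem_extChartAt_target p⟩
    rw [area_apply_of_subset g p hVo.measurableSet Set.inter_subset_right,
      chartMeasure_apply g p hVo.measurableSet, lintegral_eq_zero_iff'
      ((aemeasurable_density g p).ennreal_ofReal.mono_measure
        (Measure.restrict_mono Set.inter_subset_right le_rfl))] at h1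
    have h2 : ∀ᵐ y ∂(volume.restrict B), False := by
      filter_upwards [h1, ae_restrict_mem hBo.measurableSet] with y hy hyB
      have := density_pos g hyB.2
      simp only [Pi.zero_apply, ENNReal.ofReal_eq_zero] at hy
      linarith
    have h3 : volume B = 0 := by simpa [ae_iff] using h2
    exact (hBo.measure_pos volume hBne).ne' h3

end Area

/-! ### The divergence theorem -/

theorem integral_pderiv_eq_zero {V : Plane → ℝ} (hV : ContDiff ℝ ∞ V) (hc : HasCompactSupport V)
    (i : Fin 2) : Integrable (pderiv i V) ∧ ∫ y, pderiv i V y = 0 := by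
  have hcont : Continuous (pderiv i V) :=
    (hV.continuous_fderiv (by simp)).clm_apply continuous_const
  have hsupp : HasCompactSupport (pderiv i V) := hc.fderiv_apply ℝ _
  have hint : Integrable (pderiv i V) := hcont.integrable_of_hasCompactSupport hsupp
  refine ⟨hint, ?_⟩
  have h := integral_mul_fderiv_eq_neg_fderiv_mul_of_integrable (μ := (volume : Measure Plane))
    (f := fun _ => (1 : ℝ)) (g := V) (v := EuclideanSpace.single i 1) (by simp)
    (by simp only [one_mul]; exact hint) (by simpa using hV.continuous.integrable_of_hasCompactSupport hc)
    (fun _ _ => differentiableAt_const _) (fun x _ => hV.differentiable (by simp) x)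
  simpa [pderiv] using h

section Divergence

variable {S : Type*} [TopologicalSpace S] [ChartedSpace Plane S]

/-- The function on the surface that is given by the expressions `f c` in the charts, each point
being evaluated in the chart around itself. -/
def onSurface (f : S → Plane → ℝ) (p : S) : ℝ := f p (coord p)

theorem IsScalar.onSurface_symm {f : S → Plane → ℝ} (hf : IsScalar f) {c : S} {y : Plane}
    (hy : y ∈ (extChartAt (𝓡 2) c).target) :
    onSurface f ((extChartAt (𝓡 2) c).symm y) = f c y :=
  (hf.transform c _ y ⟨hy, mem_extChartAt_source _⟩).symm

theorem IsScalar.continuous_onSurface {f : S → Plane → ℝ} (hf : IsScalar f) :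
    Continuous (onSurface f) := by
  refine continuous_iff_continuousAt.2 fun p => ?_
  have h1 : ContinuousOn (fun q => f p (extChartAt (𝓡 2) p q)) (extChartAt (𝓡 2) p).source :=
    (hf.smooth p).continuousOn.comp (continuousOn_extChartAt p)
      fun q hq => (extChartAt (𝓡 2) p).map_source hq
  refine (h1.continuousAt (extChartAt_source_mem_nhds p)).congr ?_
  filter_upwards [extChartAt_source_mem_nhds (I := 𝓡 2) p] with q hq
  rw [← hf.onSurface_symm ((extChartAt (𝓡 2) p).map_source hq), (extChartAt (𝓡 2) p).left_inv hq]

variable [IsManifold (𝓡 2) ∞ S]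

theorem pderiv_density (g : Metric S) {c : S} {y : Plane}
    (hy : y ∈ (extChartAt (𝓡 2) c).target) (i : Fin 2) :
    pderiv i (density g c) y = density g c y * ∑ l, christoffel g c l i l y := by
  have hG := differentiableAt_gram g hy
  have hd := differentiableAt_of_contDiffOn (isOpen_target c) (contDiffOn_density g c) hy
  have hpos := density_pos g hy
  have h1 : pderiv i (fun z => density g c z * density g c z) y = pderiv i (fun z =>
      gram g c z 0 0 * gram g c z 1 1 - gram g c z 0 1 * gram g c z 0 1) y := by
    refine pderiv_congr ?_
    filter_upwards [(isOpen_target c).mem_nhds hy] with z hz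
    rw [density, Real.mul_self_sqrt (gram_det_pos g hz).le, gram_det]
    ring
  have h2 : density g c y * density g c y
      = gram g c y 0 0 * gram g c y 1 1 - gram g c y 0 1 ^ 2 := by
    rw [density, Real.mul_self_sqrt (gram_det_pos g hy).le, gram_det]
  rw [pderiv_mul hd hd, pderiv_sub ((hG _ _).fun_mul (hG _ _)) ((hG _ _).fun_mul (hG _ _)),
    pderiv_mul (hG _ _) (hG _ _), pderiv_mul (hG _ _) (hG _ _)] at h1
  simp only [pderiv_gram g hy, Fin.sum_univ_two, gram_symm g c y 1 0] at h1
  rw [Fin.sum_univ_two]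
  refine mul_left_cancel₀ (mul_ne_zero two_ne_zero hpos.ne') ?_
  linear_combination h1
    - 2 * (christoffel g c 0 i 0 y + christoffel g c 1 i 1 y) * h2

/-- The divergence as a divergence of densities in the plane. -/
theorem density_mul_divergence (g : Metric S) {w : S → Fin 2 → Plane → ℝ} (hw : IsCovector w)
    {c : S} {y : Plane} (hy : y ∈ (extChartAt (𝓡 2) c).target) :
    density g c y * divergence g w c y = ∑ i, pderiv i (fun z => ∑ j,
      density g c z * gramInv g c z i j * w c j z) y := by
  have hh := differentiableAt_gramInv g hy
  have hW := hw.differentiableAt hy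
  have hd := differentiableAt_of_contDiffOn (isOpen_target c) (contDiffOn_density g c) hy
  have h1 := fun i j => hd.fun_mul (hh i j)
  have h2 := fun i j => (h1 i j).fun_mul (hW j)
  have hp : ∀ i, pderiv i (fun z => ∑ j, density g c z * gramInv g c z i j * w c j z) y
      = ∑ j, ((pderiv i (density g c) y * gramInv g c y i j
        + density g c y * pderiv i (fun z => gramInv g c z i j) y) * w c j y
        + density g c y * gramInv g c y i j * pderiv i (w c j) y) := by
    intro i
    rw [pderiv_sum fun j _ => h2 i j]
    refine Finset.sum_congr rfl fun j _ => ?_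
    rw [pderiv_mul (h1 i j) (hW j), pderiv_mul hd (hh i j)]
  simp only [hp]
  simp only [pderiv_density g hy, pderiv_gramInv g hy, divergence, trace₂, covD₁,
    Fin.sum_univ_two, christoffel_symm g c _ 1 0, gramInv_symm g c y 1 0]
  ring

theorem IsCovector.isScalar_divergence (g : Metric S) {w : S → Fin 2 → Plane → ℝ}
    (hw : IsCovector w) : IsScalar (divergence g w) := (hw.covD₁ g).trace₂ g

theorem divergence_eq_zero_of_eventuallyEq (g : Metric S) {w : S → Fin 2 → Plane → ℝ} {c : S}
    {y : Plane} (h : ∀ j, w c j =ᶠ[nhds y] fun _ => 0) : divergence g w c y = 0 := by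
  have h1 : ∀ i j, covD₁ g w c i j y = 0 := fun i j => by
    rw [covD₁, pderiv_congr (h j), pderiv_const, Finset.sum_eq_zero, sub_zero]
    intro k _
    rw [(h k).eq_of_nhds, mul_zero]
  simp only [divergence, trace₂, h1, mul_zero, Finset.sum_const_zero]

variable [T2Space S] [MeasurableSpace S] [BorelSpace S]

/-- The divergence theorem for a one-form with compact support in the domain of a chart. -/
theorem integral_divergence_eq_zero_of_compact (g : Metric S) {w : S → Fin 2 → Plane → ℝ}
    (hw : IsCovector w) (c : S) {K : Set S} (hK : IsCompact K)
    (hKc : K ⊆ (extChartAt (𝓡 2) c).source)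
    (hzero : ∀ d j y, (extChartAt (𝓡 2) d).symm y ∉ K → w d j y = 0) :
    ∫ p, onSurface (divergence g w) p ∂(area g) = 0 := by
  have hscal := hw.isScalar_divergence g
  -- the divergence vanishes off `K`
  have hevent : ∀ d, ∀ y ∈ (extChartAt (𝓡 2) d).target, (extChartAt (𝓡 2) d).symm y ∉ K →
      ∀ j, w d j =ᶠ[nhds y] fun _ => 0 := by
    intro d y hy hyK j
    have hopen : IsOpen ((extChartAt (𝓡 2) d).target ∩ (extChartAt (𝓡 2) d).symm ⁻¹' Kᶜ) :=
      (continuousOn_extChartAt_symm d).isOpen_inter_preimage (isOpen_target d)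
        hK.isClosed.isOpen_compl
    filter_upwards [hopen.mem_nhds ⟨hy, hyK⟩] with z hz
    exact hzero d j z hz.2
  have hoff : ∀ p, p ∉ (extChartAt (𝓡 2) c).source →
      onSurface (divergence g w) p = 0 := by
    intro p hp
    refine divergence_eq_zero_of_eventuallyEq g fun j => hevent p _ (mem_extChartAt_target p) ?_ j
    rw [extChartAt_to_inv]
    exact fun h => hp (hKc h)
  rw [← setIntegral_eq_integral_of_forall_compl_eq_zero hoff,
    setIntegral_area_source g c hscal.continuous_onSurface]
  -- the density-weighted vector field, extended by zero to the plane
  set V : Fin 2 → Plane → ℝ := fun i => (extChartAt (𝓡 2) c).target.indicator fun z =>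
    ∑ j, density g c z * gramInv g c z i j * w c j z with hV
  set K' : Set Plane := extChartAt (𝓡 2) c '' K with hK'
  have hK'c : IsCompact K' := hK.image_of_continuousOn ((continuousOn_extChartAt c).mono hKc)
  have hVoff : ∀ i, ∀ y ∉ K', V i y = 0 := by
    intro i y hy
    by_cases hyt : y ∈ (extChartAt (𝓡 2) c).target
    · rw [hV]
      simp only [Set.indicator_of_mem hyt]
      refine Finset.sum_eq_zero fun j _ => ?_
      rw [hzero c j y, mul_zero]
      exact fun h => hy ⟨_, h, (extChartAt (𝓡 2) c).right_inv hyt⟩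
    · exact Set.indicator_of_notMem hyt _
  have hVsupp : ∀ i, HasCompactSupport (V i) := fun i =>
    HasCompactSupport.intro hK'c (hVoff i)
  have hVon : ∀ i, ∀ y ∈ (extChartAt (𝓡 2) c).target, V i =ᶠ[nhds y] fun z =>
      ∑ j, density g c z * gramInv g c z i j * w c j z := by
    intro i y hy
    filter_upwards [(isOpen_target c).mem_nhds hy] with z hz
    exact Set.indicator_of_mem hz _
  have hVz : ∀ i, ∀ y ∉ (extChartAt (𝓡 2) c).target, V i =ᶠ[nhds y] fun _ => 0 := by
    intro i y hy
    have hyK : y ∉ K' := by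
      rintro ⟨p, hp, rfl⟩
      exact hy ((extChartAt (𝓡 2) c).map_source (hKc hp))
    filter_upwards [hK'c.isClosed.isOpen_compl.mem_nhds hyK] with z hz
    exact hVoff i z hz
  have hVsmooth : ∀ i, ContDiff ℝ ∞ (V i) := by
    intro i
    refine contDiff_iff_contDiffAt.2 fun y => ?_
    by_cases hy : y ∈ (extChartAt (𝓡 2) c).target
    · have h1 : ContDiffOn ℝ ∞ (fun z => ∑ j, density g c z * gramInv g c z i j * w c j z)
          (extChartAt (𝓡 2) c).target := ContDiffOn.sum fun j _ =>
        ((contDiffOn_density g c).mul (contDiffOn_gramInv g c i j)).mul (hw.smooth c j)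
      exact (h1.contDiffAt ((isOpen_target c).mem_nhds hy)).congr_of_eventuallyEq (hVon i y hy)
    · exact contDiffAt_const.congr_of_eventuallyEq (hVz i y hy)
  have hflat : ∫ y in (extChartAt (𝓡 2) c).target,
      density g c y * onSurface (divergence g w) ((extChartAt (𝓡 2) c).symm y)
      = ∫ y in (extChartAt (𝓡 2) c).target, ∑ i, pderiv i (V i) y := by
    refine setIntegral_congr_fun (measurableSet_target c) fun y hy => ?_
    simp only [hscal.onSurface_symm hy, density_mul_divergence g hw hy]
    exact Finset.sum_congr rfl fun i _ => (pderiv_congr (hVon i y hy)).symm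
  rw [hflat, setIntegral_eq_integral_of_forall_compl_eq_zero fun y hy =>
      Finset.sum_eq_zero fun i _ => by rw [pderiv_congr (hVz i y hy), pderiv_const],
    integral_finsetSum _ fun i _ => (integral_pderiv_eq_zero (hVsmooth i) (hVsupp i) i).1]
  exact Finset.sum_eq_zero fun i _ => (integral_pderiv_eq_zero (hVsmooth i) (hVsupp i) i).2

omit [T2Space S] [MeasurableSpace S] [BorelSpace S] in
/-- The product of a one-form with a smooth function. -/
theorem IsCovector.smul {w : S → Fin 2 → Plane → ℝ} (hw : IsCovector w) {ρ : S → ℝ}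
    (hρ : ContMDiff (𝓡 2) 𝓘(ℝ, ℝ) ∞ ρ) :
    IsCovector (fun c j y => ρ ((extChartAt (𝓡 2) c).symm y) * w c j y) where
  smooth c j := by
    refine ContDiffOn.mul ?_ (hw.smooth c j)
    rw [← contMDiffOn_iff_contDiffOn]
    exact hρ.comp_contMDiffOn (contMDiffOn_extChartAt_symm (I := 𝓡 2) (n := ∞) c)
  transform c d y hy j := by
    rw [hw.transform c d y hy, symm_trans hy, Finset.mul_sum]
    exact Finset.sum_congr rfl fun a _ => by ring

variable [CompactSpace S]

/-- The divergence theorem on a compact surface. -/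
theorem integral_divergence_eq_zero (g : Metric S) {w : S → Fin 2 → Plane → ℝ}
    (hw : IsCovector w) :
    Integrable (onSurface (divergence g w)) (area g) ∧
      ∫ p, onSurface (divergence g w) p ∂(area g) = 0 := by
  have hint : ∀ {w : S → Fin 2 → Plane → ℝ}, IsCovector w →
      Integrable (onSurface (divergence g w)) (area g) := fun hw =>
    (hw.isScalar_divergence g).continuous_onSurface.integrable_of_hasCompactSupport
      (HasCompactSupport.of_compactSpace _)
  refine ⟨hint hw, ?_⟩
  obtain ⟨ρ, hρ⟩ := SmoothPartitionOfUnity.exists_isSubordinate_chartAt_source (𝓡 2) S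
  have hfin := ρ.locallyFinite.finite_nonempty_of_compact
  set t : Finset S := hfin.toFinset with ht
  set v : S → S → Fin 2 → Plane → ℝ := fun q c j y => ρ q ((extChartAt (𝓡 2) c).symm y) * w c j y
    with hv
  have hvc : ∀ q, IsCovector (v q) := fun q => hw.smul (ρ q).contMDiff
  have hsum : ∀ p, ∑ q ∈ t, ρ q p = 1 := by
    intro p
    rw [← ρ.sum_eq_one (Set.mem_univ p)]
    refine (finsum_eq_sum_of_support_subset _ fun q hq => ?_).symm
    rw [ht, Set.Finite.coe_toFinset]
    exact ⟨p, hq⟩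
  have hw_sum : ∀ c j, w c j = fun y => ∑ q ∈ t, v q c j y := fun c j => by
    funext y
    rw [← Finset.sum_mul, hsum, one_mul]
  have hdiv : ∀ p, onSurface (divergence g w) p
      = ∑ q ∈ t, onSurface (divergence g (v q)) p := by
    intro p
    have hD : ∀ q j, DifferentiableAt ℝ (v q p j) (coord p) := fun q =>
      (hvc q).differentiableAt (mem_extChartAt_target p)
    have hcov : ∀ i j, covD₁ g w p i j (coord p) = ∑ q ∈ t, covD₁ g (v q) p i j (coord p) := by
      intro i j
      simp only [covD₁]
      rw [hw_sum p j, pderiv_sum fun q _ => hD q j, Finset.sum_sub_distrib, Finset.sum_comm]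
      simp only [hw_sum p, Finset.mul_sum]
    simp only [onSurface, divergence, trace₂, hcov, Finset.mul_sum, Fin.sum_univ_two,
      Finset.sum_add_distrib]
  simp only [hdiv]
  rw [integral_finsetSum _ fun q _ => hint (hvc q)]
  refine Finset.sum_eq_zero fun q _ => ?_
  refine integral_divergence_eq_zero_of_compact g (hvc q) q
    (isClosed_tsupport (ρ q)).isCompact ?_ fun d j y hy => ?_
  · rw [extChartAt_source]; exact hρ q
  · have : ρ q ((extChartAt (𝓡 2) d).symm y) = 0 := image_eq_zero_of_notMem_tsupport hy
    simp only [hv, this, zero_mul]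

end Divergence

/-! ### Integrated Bochner formulas and vanishing -/

section Integrated

variable {S : Type*} [TopologicalSpace S] [ChartedSpace Plane S] [IsManifold (𝓡 2) ∞ S]

omit [IsManifold (𝓡 2) ∞ S] in
theorem IsTensor₂.antisymm {w : S → Fin 2 → Fin 2 → Plane → ℝ} (hw : IsTensor₂ w) :
    IsTensor₂ (fun c i j y => w c i j y - w c j i y) where
  smooth c i j := (hw.smooth c i j).sub (hw.smooth c j i)
  transform c d y hy i j := by
    rw [hw.transform c d y hy i j, hw.transform c d y hy j i]
    simp only [Fin.sum_univ_two]
    ring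

theorem OneForm.bochner (g : Metric S) (β : OneForm S) (p : S) :
    normSq₂ g p (β.cov g p) + gaussCurvature g p * normSq₁ g p (β.val p)
      = ((1 / 2) * normSq₂ g p (β.curl g p) + β.div g p ^ 2)
        + onSurface (divergence g (flux₁ g β.comp)) p :=
  bochner₁ g β.isCovector_comp (mem_extChartAt_target p)

theorem OneForm.continuous_curl_div (g : Metric S) (β : OneForm S) :
    Continuous fun p => (1 / 2) * normSq₂ g p (β.curl g p) + β.div g p ^ 2 :=
  ((((β.isCovector_comp.covD₁ g).antisymm.lengthSq₂ g).continuous_onSurface).const_mul _).add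
    ((β.isCovector_comp.isScalar_divergence g).continuous_onSurface.pow 2)

theorem TwoTensor.comp_symm {Z : TwoTensor S} (hZ : Z.IsSymmetric) (c : S) (i j : Fin 2) :
    Z.comp c i j = Z.comp c j i := funext fun _ => hZ _ _ _

theorem TwoTensor.trace_eq_zero {g : Metric S} {Z : TwoTensor S} (hZ : Z.IsTraceFree g) (c : S)
    {y : Plane} (hy : y ∈ (extChartAt (𝓡 2) c).target) : trace₂ g Z.comp c y = 0 := by
  rw [← (Z.isTensor₂_comp.trace₂ g).onSurface_symm hy]
  exact hZ _

theorem TwoTensor.bochner (g : Metric S) {Z : TwoTensor S} (hs : Z.IsSymmetric)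
    (ht : Z.IsTraceFree g) (p : S) :
    normSq₃ g p (Z.cov g p) + 2 * gaussCurvature g p * normSq₂ g p (Z.val p)
      = 2 * normSq₁ g p (Z.div g p) + onSurface (divergence g (flux₂ g Z.comp)) p :=
  bochner₂ g Z.isTensor₂_comp (comp_symm hs) (fun c _ hz => trace_eq_zero ht c hz)
    (mem_extChartAt_target p)

theorem TwoTensor.continuous_normSq_div (g : Metric S) (Z : TwoTensor S) :
    Continuous fun p => normSq₁ g p (Z.div g p) :=
  (((Z.isTensor₂_comp.covD₂ g).trace₃ g).lengthSq₁ g).continuous_onSurface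

/-! ### Positivity of the contractions -/

/-- An orthonormal coframe for the inverse metric at a point: `g^{ab} = ∑ m, e a m * e b m`. -/
theorem exists_coframe (g : Metric S) (p : S) : ∃ e : Fin 2 → Fin 2 → ℝ,
    (∀ a b, metInv g p a b = ∑ m, e a m * e b m) ∧ e 0 0 * e 1 1 - e 0 1 * e 1 0 ≠ 0 := by
  have hy : coord p ∈ (extChartAt (𝓡 2) p).target := mem_extChartAt_target p
  have hd := gram_det_pos g hy
  have hdet := gram_det g p (coord p)
  have h11 : 0 < gram g p (coord p) 1 1 := by
    have := gram_quadratic_pos g hy (a := 0) (b := 1) (by simp)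
    linarith
  set G := gram g p (coord p) with hG
  -- the Cholesky factorization of the inverse matrix
  have hI : metInv g p = !![G 1 1 / G.det, -G 0 1 / G.det; -G 0 1 / G.det, G 0 0 / G.det] :=
    gramInv_eq g p (coord p)
  have s1 := Real.mul_self_sqrt h11.le
  have s2 := Real.mul_self_sqrt hd.le
  have p1 := Real.sqrt_pos.2 h11
  have p2 := Real.sqrt_pos.2 hd
  set r := Real.sqrt (G 1 1)
  set s := Real.sqrt G.det
  refine ⟨![![r / s, 0], ![-G 0 1 / (r * s), 1 / r]], ?_, ?_⟩
  · intro a b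
    rw [hI, ← s2]
    have h3 : G 0 0 * (r * r) = s * s + G 0 1 ^ 2 := by rw [s1, s2, hdet]; ring
    fin_cases a <;> fin_cases b <;> simp [Fin.sum_univ_two, ← s1] <;> field_simp
    linear_combination h3
  · simp [p1.ne', p2.ne']

theorem normSq₁_nonneg (g : Metric S) (p : S) (v : Fin 2 → ℝ) : 0 ≤ normSq₁ g p v := by
  obtain ⟨e, he, -⟩ := exists_coframe g p
  have : normSq₁ g p v = ∑ m, (∑ a, e a m * v a) ^ 2 := by
    simp only [normSq₁, he, Fin.sum_univ_two]; ring
  rw [this]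
  positivity

theorem eq_zero_of_normSq₁ (g : Metric S) (p : S) {v : Fin 2 → ℝ} (h : normSq₁ g p v ≤ 0) :
    ∀ a, v a = 0 := by
  obtain ⟨e, he, hd⟩ := exists_coframe g p
  have h1 : normSq₁ g p v = (e 0 0 * v 0 + e 1 0 * v 1) ^ 2 + (e 0 1 * v 0 + e 1 1 * v 1) ^ 2 := by
    simp only [normSq₁, he, Fin.sum_univ_two]; ring
  have h2 : e 0 0 * v 0 + e 1 0 * v 1 = 0 := by nlinarith
  have h3 : e 0 1 * v 0 + e 1 1 * v 1 = 0 := by nlinarith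
  have h4 : v 0 = 0 := mul_left_cancel₀ hd (by linear_combination e 1 1 * h2 - e 1 0 * h3)
  have h5 : v 1 = 0 := mul_left_cancel₀ hd (by linear_combination e 0 0 * h3 - e 0 1 * h2)
  intro a
  fin_cases a
  exacts [h4, h5]

theorem normSq₂_eq (g : Metric S) (p : S) {e : Fin 2 → Fin 2 → ℝ}
    (he : ∀ a b, metInv g p a b = ∑ m, e a m * e b m) (T : Fin 2 → Fin 2 → ℝ) :
    normSq₂ g p T = ∑ m, normSq₁ g p (fun b => ∑ a, e a m * T a b) := by
  simp only [normSq₂, normSq₁, he, Fin.sum_univ_two]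
  ring

theorem normSq₂_nonneg (g : Metric S) (p : S) (T : Fin 2 → Fin 2 → ℝ) : 0 ≤ normSq₂ g p T := by
  obtain ⟨e, he, -⟩ := exists_coframe g p
  rw [normSq₂_eq g p he]
  exact Finset.sum_nonneg fun m _ => normSq₁_nonneg g p _

theorem eq_zero_of_normSq₂ (g : Metric S) (p : S) {T : Fin 2 → Fin 2 → ℝ}
    (h : normSq₂ g p T ≤ 0) : ∀ a b, T a b = 0 := by
  obtain ⟨e, he, hd⟩ := exists_coframe g p
  rw [normSq₂_eq g p he, Fin.sum_univ_two] at h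
  have n0 := normSq₁_nonneg g p (fun b => ∑ a, e a 0 * T a b)
  have n1 := normSq₁_nonneg g p (fun b => ∑ a, e a 1 * T a b)
  intro a b
  have h2 := eq_zero_of_normSq₁ g p (le_trans (by linarith) h) b
    (v := fun b => ∑ a, e a 0 * T a b)
  have h3 := eq_zero_of_normSq₁ g p (le_trans (by linarith) h) b
    (v := fun b => ∑ a, e a 1 * T a b)
  simp only [Fin.sum_univ_two] at h2 h3
  have h4 : T 0 b = 0 := mul_left_cancel₀ hd (by linear_combination e 1 1 * h2 - e 1 0 * h3)
  have h5 : T 1 b = 0 := mul_left_cancel₀ hd (by linear_combination e 0 0 * h3 - e 0 1 * h2)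
  fin_cases a
  exacts [h4, h5]

theorem normSq₃_nonneg (g : Metric S) (p : S) (T : Fin 2 → Fin 2 → Fin 2 → ℝ) :
    0 ≤ normSq₃ g p T := by
  obtain ⟨e, he, -⟩ := exists_coframe g p
  have : normSq₃ g p T = ∑ m, normSq₂ g p (fun b c => ∑ a, e a m * T a b c) := by
    simp only [normSq₃, normSq₂, Fin.sum_univ_two, he 0 0, he 0 1, he 1 0, he 1 1]
    ring
  rw [this]
  exact Finset.sum_nonneg fun m _ => normSq₂_nonneg g p _

/-- A linear map that vanishes on the coordinate vector fields vanishes. -/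
theorem eq_zero_of_frame {c : S} {y : Plane} (hy : y ∈ (extChartAt (𝓡 2) c).target)
    {E : Type*} [NormedAddCommGroup E] [NormedSpace ℝ E] {L : Plane →L[ℝ] E}
    (h : ∀ i, L (frame c y (EuclideanSpace.single i 1)) = 0) : L = 0 := by
  ext u
  obtain ⟨v, rfl⟩ := (bijective_frame hy).2 u
  have hv : v = v 0 • EuclideanSpace.single 0 (1 : ℝ) + v 1 • EuclideanSpace.single 1 (1 : ℝ) := by
    ext b
    fin_cases b <;> simp
  rw [hv, map_add, map_smul, map_smul, map_add, map_smul, map_smul, h, h]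
  simp

theorem OneForm.eq_zero_of_val {β : OneForm S} {p : S} (h : ∀ a, β.val p a = 0) : β p = 0 := by
  let B : S → Plane →L[ℝ] ℝ := fun q => β q
  have h1 : ∀ a, B ((extChartAt (𝓡 2) p).symm (extChartAt (𝓡 2) p p))
      (frame p (coord p) (EuclideanSpace.single a 1)) = 0 := h
  rw [extChartAt_to_inv] at h1
  exact eq_zero_of_frame (mem_extChartAt_target p) h1

theorem TwoTensor.eq_zero_of_val {Z : TwoTensor S} {p : S} (h : ∀ a b, Z.val p a b = 0) :
    Z p = 0 := by
  let B : S → Plane →L[ℝ] Plane →L[ℝ] ℝ := fun q => Z q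
  have h1 : ∀ a b, B ((extChartAt (𝓡 2) p).symm (extChartAt (𝓡 2) p p))
      (frame p (coord p) (EuclideanSpace.single a 1))
      (frame p (coord p) (EuclideanSpace.single b 1)) = 0 := h
  rw [extChartAt_to_inv] at h1
  exact eq_zero_of_frame (mem_extChartAt_target p) fun a =>
    eq_zero_of_frame (mem_extChartAt_target p) (h1 a)

variable [T2Space S] [CompactSpace S] [MeasurableSpace S] [BorelSpace S]

/-- A nonnegative divergence vanishes on a compact surface. -/
theorem divergence_eq_zero_of_nonneg (g : Metric S) {w : S → Fin 2 → Plane → ℝ}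
    (hw : IsCovector w) (h : ∀ p, 0 ≤ onSurface (divergence g w) p) (p : S) :
    onSurface (divergence g w) p = 0 := by
  obtain ⟨h1, h2⟩ := integral_divergence_eq_zero g hw
  rw [integral_eq_zero_iff_of_nonneg h h1, (hw.isScalar_divergence
    g).continuous_onSurface.ae_eq_iff_eq (area g) continuous_zero] at h2
  exact congrFun h2 p

end Integrated

end Surface

end

theorem mainTheorem10 {S : Type*} [TopologicalSpace S] [ChartedSpace Surface.Plane S]
    [IsManifold (𝓡 2) ∞ S] [T2Space S] [CompactSpace S] [MeasurableSpace S] [BorelSpace S]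
    (g : Surface.Metric S) :
    (∀ β : Surface.OneForm S,
      Integrable (fun p => Surface.normSq₂ g p (β.cov g p)
        + Surface.gaussCurvature g p * Surface.normSq₁ g p (β.val p)) (Surface.area g) ∧
      Integrable (fun p => (1 / 2) * Surface.normSq₂ g p (β.curl g p) + (β.div g p) ^ 2)
        (Surface.area g) ∧
      ∫ p, (Surface.normSq₂ g p (β.cov g p)
          + Surface.gaussCurvature g p * Surface.normSq₁ g p (β.val p)) ∂(Surface.area g)
        = ∫ p, ((1 / 2) * Surface.normSq₂ g p (β.curl g p) + (β.div g p) ^ 2)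
            ∂(Surface.area g)) ∧
    (∀ Z : Surface.TwoTensor S, Z.IsSymmetric → Z.IsTraceFree g →
      Integrable (fun p => Surface.normSq₃ g p (Z.cov g p)
        + 2 * Surface.gaussCurvature g p * Surface.normSq₂ g p (Z.val p)) (Surface.area g) ∧
      Integrable (fun p => Surface.normSq₁ g p (Z.div g p)) (Surface.area g) ∧
      ∫ p, (Surface.normSq₃ g p (Z.cov g p)
          + 2 * Surface.gaussCurvature g p * Surface.normSq₂ g p (Z.val p)) ∂(Surface.area g)
        = 2 * ∫ p, Surface.normSq₁ g p (Z.div g p) ∂(Surface.area g)) ∧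
    ((∀ p : S, 0 < Surface.gaussCurvature g p) →
      (∀ β : Surface.OneForm S, (∀ p, β.div g p = 0) → (∀ p a b, β.curl g p a b = 0) →
        ∀ p, β p = 0) ∧
      (∀ Z : Surface.TwoTensor S, Z.IsSymmetric → Z.IsTraceFree g →
        (∀ p a, Z.div g p a = 0) → ∀ p, Z p = 0)) := by
  have hint : ∀ {f : S → ℝ}, Continuous f → Integrable f (Surface.area g) := fun hf =>
    hf.integrable_of_hasCompactSupport (HasCompactSupport.of_compactSpace _)
  refine ⟨fun β => ?_, fun Z hs ht => ?_, fun hK => ⟨fun β hdiv hcurl p => ?_,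
    fun Z hs ht hdiv p => ?_⟩⟩
  · obtain ⟨h1, h2⟩ :=
      Surface.integral_divergence_eq_zero g (β.isCovector_comp.flux₁ g)
    have h3 := hint (β.continuous_curl_div g)
    simp only [Surface.OneForm.bochner]
    refine ⟨h3.add h1, h3, ?_⟩
    rw [integral_add h3 h1, h2, add_zero]
  · obtain ⟨h1, h2⟩ :=
      Surface.integral_divergence_eq_zero g (Z.isTensor₂_comp.flux₂ g)
    have h3 := hint (Z.continuous_normSq_div g)
    simp only [Surface.TwoTensor.bochner g hs ht]
    refine ⟨(h3.const_mul 2).add h1, h3, ?_⟩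
    rw [integral_add (h3.const_mul 2) h1, h2, add_zero, integral_const_mul]
  · have hb : ∀ q, Surface.normSq₂ g q (β.cov g q)
        + Surface.gaussCurvature g q * Surface.normSq₁ g q (β.val q)
        = Surface.onSurface (Surface.divergence g (Surface.flux₁ g β.comp)) q := fun q => by
      rw [Surface.OneForm.bochner, hdiv]
      simp [Surface.normSq₂, hcurl]
    have hzero := Surface.divergence_eq_zero_of_nonneg g (β.isCovector_comp.flux₁ g)
      (fun q => by
        rw [← hb]
        exact add_nonneg (Surface.normSq₂_nonneg g q _)
          (mul_nonneg (hK q).le (Surface.normSq₁_nonneg g q _))) p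
    rw [← hb] at hzero
    refine Surface.OneForm.eq_zero_of_val (Surface.eq_zero_of_normSq₁ g p ?_)
    refine nonpos_of_mul_nonpos_right ?_ (hK p)
    linarith [Surface.normSq₂_nonneg g p (β.cov g p)]
  · have hb : ∀ q, Surface.normSq₃ g q (Z.cov g q)
        + 2 * Surface.gaussCurvature g q * Surface.normSq₂ g q (Z.val q)
        = Surface.onSurface (Surface.divergence g (Surface.flux₂ g Z.comp)) q := fun q => by
      rw [Surface.TwoTensor.bochner g hs ht]
      simp [Surface.normSq₁, hdiv]
    have hK2 : ∀ q, 0 < 2 * Surface.gaussCurvature g q := fun q => mul_pos two_pos (hK q)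
    have hzero := Surface.divergence_eq_zero_of_nonneg g (Z.isTensor₂_comp.flux₂ g)
      (fun q => by
        rw [← hb]
        exact add_nonneg (Surface.normSq₃_nonneg g q _)
          (mul_nonneg (hK2 q).le (Surface.normSq₂_nonneg g q _))) p
    rw [← hb] at hzero
    refine Surface.TwoTensor.eq_zero_of_val (Surface.eq_zero_of_normSq₂ g p ?_)
    refine nonpos_of_mul_nonpos_right ?_ (hK2 p)
    linarith [Surface.normSq₃_nonneg g p (Z.cov g p)]
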